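/- Let $M$ be a smooth (Hausdorff, finite-dimensional, boundaryless) manifold and let $\nabla$ be a smooth torsion-free linear connection on $M$. Let $D=\dot x^j\,\partial/\partial x^j-\Gamma^j_{kl}(x)\dot x^k\dot x^l\,\partial/\partial\dot x^j$ be the geodesic field of $\nabla$ on $TM$. For $x_0\in M$ let $\exp_{x_0}$ be the exponential map: $\exp_{x_0}(v)$ is the value at time $1$ of the geodesic (projection to $M$ of an integral curve of $D$ defined on an open interval containing $[0,1]$) with initial point $x_0$ and initial velocity $v$; its domain is the set of $v\in T_{x_0}M$ for which such a geodesic exists. For a smooth function $f$ on $M$ put $\nabla^0f=f$ and $\nabla^{r+1}f=\nabla(\nabla^rf)$, where for a covariant tensor field $T$ of order $r$ $$(\nabla T)(V,W_1,\dots,W_r)=V\bigl(T(W_1,\dots,W_r)\bigr)-\sum_{i=1}^rT(W_1,\dots,\nabla_VW_i,\dots,W_r),$$ and let $\nabla^r_{x_0,\mathrm{sym}}f$ be the symmetrization of $\nabla^rf$ at $x_0$, i.e. the average of $\nabla^r_{x_0}f$ over all permutations of its $r$ arguments. Let $d^r_{x_0}f$ be the covariant tensor of order $r$ at $x_0$ that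 corresponds, under the canonical isomorphism $T_0(T_{x_0}M)\cong T_{x_0}M$, to the $r$-th ordinary differential at $0$ of the function $f\circ\exp_{x_0}$ on the vector space $T_{x_0}M$: $$d^r_{x_0}f=\sum_{j_1,\dots,j_r}\frac{\partial^r(f\circ\exp_{x_0})}{\partial\dot x^{j_1}\cdots\partial\dot x^{j_r}}(0)\;d_{x_0}x^{j_1}\cdots d_{x_0}x^{j_r}.$$ Then, for every $x_0\in M$, the domain of $\exp_{x_0}$ is a neighbourhood of $0$ in $T_{x_0}M$; for every smooth $f\colon M\to\mathbb R$ the function $f\circ\exp_{x_0}$ is smooth at $0$; and for every order $r\ge 0$ $$d^r_{x_0}f=\nabla^r_{x_0,\mathrm{sym}}f .$$ As a consequence, the exponential-map quantization and the direct connection quantization coincide: for every $\hbar\in\mathbb R$, every (not necessarily homogeneous) contravariant tensor field $\Phi=\Phi_0+\dots+\Phi_N$ with complex coefficients, $\Phi_r$ being homogeneous of order $r$ (in particular for every symmetric one), and every smooth $f\colon M\to\mathbb C$, $$\sum_{r=0}^N(-i\hbar)^r\,\langle\Phi_r(x),\,d^r_xf\rangle=\sum_{r=0}^N(-i\hbar)^r\,\langle\Phi_r(x),\,\nabla^r_{x,\mathrm{sym}}f\rangle\qquad\text{for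 all }x\in M,$$ where $\langle\ ,\ \rangle$ is the contraction of tensors (complex-linear in each argument), the left side is the quantization of $\Phi$ by the exponential map applied to $f$ (on each fibre $T_xM$ the constant tensor $\Phi_r(x)$ is quantized and applied to $f\circ\exp_x$ at $0$), and the right side is the direct quantization of $\Phi$ by $\nabla$ applied to $f$. -/

import Mathlib

open Set Bundle Topology
open scoped Manifold ContDiff TensorProduct Nat

noncomputable section

namespace CovariantDerivative

variable {E : Type*} [NormedAddCommGroup E] [NormedSpace ℝ E]
  {M : Type*} [TopologicalSpace M] [ChartedSpace E M] [IsManifold 𝓘(ℝ, E) ∞ M]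
  {F : Type*} [NormedAddCommGroup F] [NormedSpace ℝ F]

/-- Covariant tensors of order `r` at the point `x`, with values in `F`
(real tensors for `F = ℝ`, complex ones for `F = ℂ`). -/
abbrev CovTensor (E : Type*) [NormedAddCommGroup E] [NormedSpace ℝ E]
    {M : Type*} [TopologicalSpace M] [ChartedSpace E M]
    (F : Type*) [NormedAddCommGroup F] [NormedSpace ℝ F] (r : ℕ) (x : M) : Type _ :=
  ContinuousMultilinearMap ℝ (fun _ : Fin r => TangentSpace 𝓘(ℝ, E) x) F

/-- Complex contravariant tensors of order `r` at the point `x`. -/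
abbrev ContraTensor (E : Type*) [NormedAddCommGroup E] [NormedSpace ℝ E]
    {M : Type*} [TopologicalSpace M] [ChartedSpace E M] (r : ℕ) (x : M) : Type _ :=
  ℂ ⊗[ℝ] (⨂[ℝ] _ : Fin r, TangentSpace 𝓘(ℝ, E) x)

/-! ### Christoffel symbols, geodesic field, exponential map -/

/-- The vector field with constant components `w` in the preferred chart at `x`
(on the domain of that chart, and zero elsewhere). -/
def constField (x : M) (w : E) (y : M) : TangentSpace 𝓘(ℝ, E) y :=
  (trivializationAt E (TangentSpace 𝓘(ℝ, E) : M → Type _) x).symmL ℝ y w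

lemma constField_self (x : M) (w : E) : constField x w x = w := by
  unfold constField
  rw [TangentBundle.symmL_trivializationAt_eq_core (mem_chart_source E x)]
  exact (tangentBundleCore 𝓘(ℝ, E) M).coordChange_self (achart E x) x (mem_chart_source E x) w

lemma mdifferentiableAt_constField (x : M) (w : E) :
    MDifferentiableAt 𝓘(ℝ, E) 𝓘(ℝ, E).tangent
      (fun y => (⟨y, constField x w y⟩ : TangentBundle 𝓘(ℝ, E) M)) x := by
  have hx := FiberBundle.mem_baseSet_trivializationAt' (F := E)
    (E := (TangentSpace 𝓘(ℝ, E) : M → Type _)) x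
  have h := FiberBundle.mdifferentiableAt_extend 𝓘(ℝ, E) E
    (V := (TangentSpace 𝓘(ℝ, E) : M → Type _)) (constField x w x)
  refine h.congr_of_eventuallyEq ?_
  filter_upwards [(trivializationAt E (TangentSpace 𝓘(ℝ, E) :
    M → Type _) x).open_baseSet.mem_nhds hx] with y hy
  simp only [FiberBundle.extend, constField, ← Trivialization.symmL_apply (R := ℝ) _ hy]
  congr 2
  rw [Trivialization.symmL_apply (R := ℝ) _ hx, Trivialization.apply_mk_symm _ hx]

/-- The Christoffel symbols at `x` of a linear connection, in the preferred chart at `x`: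
`christoffel cov x v w = (∇_v W)(x)`, where `W` is the vector field with constant components in
that chart and value `w` at `x`. -/
def christoffel (cov : CovariantDerivative 𝓘(ℝ, E) E (TangentSpace 𝓘(ℝ, E) : M → Type _))
    (x : M) (v w : TangentSpace 𝓘(ℝ, E) x) : TangentSpace 𝓘(ℝ, E) x :=
  cov (constField x w) x v

lemma christoffel_add (cov : CovariantDerivative 𝓘(ℝ, E) E (TangentSpace 𝓘(ℝ, E) : M → Type _))
    (x : M) (v w w' : TangentSpace 𝓘(ℝ, E) x) :
    cov.christoffel x v (w + w') = cov.christoffel x v w + cov.christoffel x v w' := by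
  have h := cov.isCovariantDerivativeOnUniv.add (x := x)
    (mdifferentiableAt_constField (E := E) x w) (mdifferentiableAt_constField (E := E) x w')
  have e : constField (E := E) (M := M) x w + constField (E := E) x w' = constField (E := E) x (w + w' : E) := by
    funext y; exact (map_add _ _ _).symm
  rw [e] at h
  exact congrArg (fun L => L v) h

lemma christoffel_smul (cov : CovariantDerivative 𝓘(ℝ, E) E (TangentSpace 𝓘(ℝ, E) : M → Type _))
    (x : M) (a : ℝ) (v w : TangentSpace 𝓘(ℝ, E) x) :
    cov.christoffel x v (a • w) = a • cov.christoffel x v w := by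
  have h := cov.isCovariantDerivativeOnUniv.smul_const (x := x) a
    (mdifferentiableAt_constField (E := E) x w)
  have e : a • constField (E := E) (M := M) x w = constField (E := E) x (a • w : E) := by
    funext y; exact (map_smul _ _ _).symm
  rw [e] at h
  exact congrArg (fun L => L v) h

/-- The Christoffel symbols as a bilinear map. -/
def christoffelₗ (cov : CovariantDerivative 𝓘(ℝ, E) E (TangentSpace 𝓘(ℝ, E) : M → Type _))
    (x : M) : TangentSpace 𝓘(ℝ, E) x →ₗ[ℝ] TangentSpace 𝓘(ℝ, E) x →ₗ[ℝ] TangentSpace 𝓘(ℝ, E) x :=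
  LinearMap.mk₂ ℝ (cov.christoffel x)
    (fun _ _ _ => map_add _ _ _) (fun _ _ _ => map_smul _ _ _)
    (cov.christoffel_add x) (fun a => cov.christoffel_smul x a)

lemma continuous_christoffel [FiniteDimensional ℝ E]
    (cov : CovariantDerivative 𝓘(ℝ, E) E (TangentSpace 𝓘(ℝ, E) : M → Type _)) (x : M) :
    Continuous fun p : TangentSpace 𝓘(ℝ, E) x × TangentSpace 𝓘(ℝ, E) x =>
      cov.christoffel x p.1 p.2 := by
  let B : E →ₗ[ℝ] E →ₗ[ℝ] E := cov.christoffelₗ x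
  let C : E →L[ℝ] E →L[ℝ] E :=
    LinearMap.toContinuousLinearMap (LinearMap.toContinuousLinearMap.toLinearMap ∘ₗ B)
  have : Continuous fun p : E × E => C p.1 p.2 := by fun_prop
  exact this

/-- The geodesic field on `TM`. At `p = (x, u)` the space `T_p(TM)` is identified by Mathlib with
`E × E` through the coordinates `(x^j, u^j)` induced by the preferred chart at `x`, and the field is
`u^j ∂/∂x^j - Γ^j_{kl}(x) u^k u^l ∂/∂u^j`. -/
def geodesicField (cov : CovariantDerivative 𝓘(ℝ, E) E (TangentSpace 𝓘(ℝ, E) : M → Type _))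
    (p : TangentBundle 𝓘(ℝ, E) M) : TangentSpace 𝓘(ℝ, E).tangent p :=
  ((p.2, -cov.christoffel p.1 p.2 p.2) : E × E)

/-- `c` is an integral curve of the geodesic field, on an open interval containing `[0, 1]`, that
starts from the tangent vector `v` at `x`; its projection to `M` is the geodesic with initial
point `x` and initial velocity `v`. -/
def IsGeodesicFrom (cov : CovariantDerivative 𝓘(ℝ, E) E (TangentSpace 𝓘(ℝ, E) : M → Type _))
    (x : M) (v : TangentSpace 𝓘(ℝ, E) x) (c : ℝ → TangentBundle 𝓘(ℝ, E) M) : Prop :=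
  c 0 = ⟨x, v⟩ ∧
    ∃ ε > 0, IsMIntegralCurveOn (I := 𝓘(ℝ, E).tangent) c cov.geodesicField (Ioo (-ε) (1 + ε))

/-- The domain in `T_x M` of the exponential map. -/
def expDomain (cov : CovariantDerivative 𝓘(ℝ, E) E (TangentSpace 𝓘(ℝ, E) : M → Type _))
    (x : M) : Set (TangentSpace 𝓘(ℝ, E) x) :=
  {v | ∃ c, cov.IsGeodesicFrom x v c}

open Classical in
/-- The exponential map of the connection on `T_x M`: the final point of the geodesic parameterized
by `[0, 1]` with initial point `x` and initial velocity `v` (and the irrelevant value `x` for `v`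
outside the domain). -/
def expMap (cov : CovariantDerivative 𝓘(ℝ, E) E (TangentSpace 𝓘(ℝ, E) : M → Type _))
    (x : M) (v : TangentSpace 𝓘(ℝ, E) x) : M :=
  if h : v ∈ cov.expDomain x then (h.choose 1).1 else x

/-- The function `f ∘ exp` on the fibre `T_x M`, a normed space through `T_x M = E`. -/
def expPullback (cov : CovariantDerivative 𝓘(ℝ, E) E (TangentSpace 𝓘(ℝ, E) : M → Type _))
    (f : M → F) (x : M) : E → F :=
  fun v => f (cov.expMap x v)

/-- The tensor `d_x^r f` at `x`: the `r`-th differential at `0` of `f ∘ exp` on the vector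
space `T_x M`. -/
def expDifferential (cov : CovariantDerivative 𝓘(ℝ, E) E (TangentSpace 𝓘(ℝ, E) : M → Type _))
    (r : ℕ) (f : M → F) (x : M) : CovTensor E F r x :=
  show E [×r]→L[ℝ] F from iteratedFDeriv ℝ r (cov.expPullback f x) 0

/-! ### Iterated covariant differential -/

/-- The components of the tensor field `T` in the preferred chart at `x`, as a map defined around
`x` with values in the multilinear maps on `E`: the value at `y` on `w` is
`T_y(W_1(y), …, W_r(y))`, with `W_i` the vector field with constant components `w_i`. -/
def tensorInChart {r : ℕ} (T : ∀ x : M, CovTensor E F r x) (x y : M) : E [×r]→L[ℝ] F :=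
  (T y).compContinuousLinearMap fun _ =>
    (trivializationAt E (TangentSpace 𝓘(ℝ, E) : M → Type _) x).symmL ℝ y

lemma tensorInChart_apply {r : ℕ} (T : ∀ x : M, CovTensor E F r x) (x y : M) (w : Fin r → E) :
    tensorInChart T x y w = T y (fun i => constField x (w i) y) := rfl

/-- The multilinear map `(v, w_1, …, w_r) ↦ T(w_1, …, Γ(v, w_i), …, w_r)`. -/
def insertTerm {r : ℕ} {x : M} (T : CovTensor E F r x)
    (Γ : TangentSpace 𝓘(ℝ, E) x →ₗ[ℝ] TangentSpace 𝓘(ℝ, E) x →ₗ[ℝ] TangentSpace 𝓘(ℝ, E) x)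
    (hΓ : Continuous fun p : TangentSpace 𝓘(ℝ, E) x × TangentSpace 𝓘(ℝ, E) x => Γ p.1 p.2)
    (i : Fin r) : CovTensor E F (r + 1) x where
  toFun m := T (Function.update (Fin.tail m) i (Γ (m 0) (m i.succ)))
  map_update_add' := by
    intro inst m j a b
    cases Subsingleton.elim inst (instDecidableEqFin (r + 1))
    induction j using Fin.cases with
    | zero => simp [Fin.tail_update_zero]
    | succ j =>
      have h0 : ∀ c, Function.update m j.succ c 0 = m 0 :=
        fun c => Function.update_of_ne (Fin.succ_ne_zero j).symm c m
      rcases eq_or_ne j i with rfl | h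
      · simp [Fin.tail_update_succ, h0]
      · have h' : i.succ ≠ j.succ := fun e => h (Fin.succ_injective _ e).symm
        simp [Fin.tail_update_succ, h0, Function.update_of_ne h', Function.update_comm h]
  map_update_smul' := by
    intro inst m j a b
    cases Subsingleton.elim inst (instDecidableEqFin (r + 1))
    induction j using Fin.cases with
    | zero => simp [Fin.tail_update_zero]
    | succ j =>
      have h0 : ∀ c, Function.update m j.succ c 0 = m 0 :=
        fun c => Function.update_of_ne (Fin.succ_ne_zero j).symm c m
      rcases eq_or_ne j i with rfl | h
      · simp [Fin.tail_update_succ, h0]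
      · have h' : i.succ ≠ j.succ := fun e => h (Fin.succ_injective _ e).symm
        simp [Fin.tail_update_succ, h0, Function.update_of_ne h', Function.update_comm h]
  cont := by
    refine T.cont.comp (Continuous.update ?_ i ?_)
    · exact continuous_pi fun j => continuous_apply j.succ
    · exact hΓ.comp (g := fun p : TangentSpace 𝓘(ℝ, E) x × TangentSpace 𝓘(ℝ, E) x => Γ p.1 p.2)
        (f := fun m : Fin (r + 1) → TangentSpace 𝓘(ℝ, E) x => (m 0, m i.succ))
        ((continuous_apply 0).prodMk (continuous_apply i.succ))

/-- The multilinear map `(v, w_1, …, w_r) ↦ v(T(W_1, …, W_r))`, where `W_i` is the vector field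
with constant components in the preferred chart at `x` and value `w_i` at `x`. -/
def derivTerm {r : ℕ} (T : ∀ x : M, CovTensor E F r x) (x : M) : CovTensor E F (r + 1) x :=
  let D : E →L[ℝ] E [×r]→L[ℝ] F := mvfderiv 𝓘(ℝ, E) (tensorInChart T x) x
  let D' : E [×r.succ]→L[ℝ] F := D.uncurryLeft
  D'

/-- The value at `x` of the covariant differential `∇T` of a tensor field `T`:
`(∇T)(v, w_1, …, w_r) = v(T(W_1, …, W_r)) - ∑ i, T(w_1, …, ∇_v W_i, …, w_r)`,
where `W_i` is the vector field with constant components in the preferred chart at `x` and value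
`w_i` at `x`. -/
def covDifferential [FiniteDimensional ℝ E]
    (cov : CovariantDerivative 𝓘(ℝ, E) E (TangentSpace 𝓘(ℝ, E) : M → Type _))
    {r : ℕ} (T : ∀ x : M, CovTensor E F r x) (x : M) : CovTensor E F (r + 1) x :=
  derivTerm T x - ∑ i : Fin r, insertTerm (T x) (cov.christoffelₗ x) (cov.continuous_christoffel x) i

/-- The defining formula of `∇T`, for a tensor field that is differentiable at `x`. -/
lemma covDifferential_apply [FiniteDimensional ℝ E]
    (cov : CovariantDerivative 𝓘(ℝ, E) E (TangentSpace 𝓘(ℝ, E) : M → Type _))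
    {r : ℕ} (T : ∀ x : M, CovTensor E F r x) (x : M)
    (hT : MDifferentiableAt 𝓘(ℝ, E) 𝓘(ℝ, E [×r]→L[ℝ] F) (tensorInChart T x) x)
    (m : Fin (r + 1) → TangentSpace 𝓘(ℝ, E) x) :
    cov.covDifferential T x m =
      mvfderiv 𝓘(ℝ, E) (fun y => T y (fun i => constField (E := E) x (m i.succ) y)) x (m 0)
      - ∑ i : Fin r, T x (Function.update (Fin.tail m) i
          (cov (constField (E := E) x (m i.succ)) x (m 0))) := by
  have h : derivTerm T x m =
      mvfderiv 𝓘(ℝ, E) (fun y => T y (fun i => constField (E := E) x (m i.succ) y)) x (m 0) := by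
    let L : (E [×r]→L[ℝ] F) →L[ℝ] F := ContinuousMultilinearMap.apply ℝ (fun _ => E) F (Fin.tail m)
    have h1 := (L.hasMFDerivAt (x := tensorInChart T x x)).comp x hT.hasMFDerivAt
    exact (congrArg (fun A => A (m 0)) h1.mfderiv).symm
  rw [← h, covDifferential, _root_.sub_apply, _root_.sum_apply]
  rfl

/-- The iterated covariant differential `∇^r f`. -/
def iteratedCovDifferential [FiniteDimensional ℝ E]
    (cov : CovariantDerivative 𝓘(ℝ, E) E (TangentSpace 𝓘(ℝ, E) : M → Type _)) (f : M → F) :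
    (r : ℕ) → (x : M) → CovTensor E F r x
  | 0 => fun x => ContinuousMultilinearMap.constOfIsEmpty ℝ _ (f x)
  | r + 1 => cov.covDifferential (cov.iteratedCovDifferential f r)

/-- The symmetrization of a covariant tensor. -/
def CovTensor.symmetrize {r : ℕ} {x : M} (T : CovTensor E F r x) : CovTensor E F r x :=
  (r ! : ℝ)⁻¹ • ∑ σ : Equiv.Perm (Fin r), T.domDomCongr σ

/-- The symmetrized iterated covariant differential `∇^r_sym f`. -/
def symCovDifferential [FiniteDimensional ℝ E]
    (cov : CovariantDerivative 𝓘(ℝ, E) E (TangentSpace 𝓘(ℝ, E) : M → Type _))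
    (r : ℕ) (f : M → F) (x : M) : CovTensor E F r x :=
  CovTensor.symmetrize (cov.iteratedCovDifferential f r x)

/-! ### The two quantizations -/

/-- The contraction `⟨Φ, T⟩`, with
`⟨z ⊗ v_1 ⊗ ⋯ ⊗ v_r, T⟩ = z T(v_1, …, v_r)`. -/
def contract {r : ℕ} {x : M} (Φ : ContraTensor E r x) (T : CovTensor E ℂ r x) : ℂ :=
  LinearMap.mul' ℝ ℂ (LinearMap.lTensor ℂ (PiTensorProduct.lift T.toMultilinearMap) Φ)

/-- The direct quantization defined by the connection, for the contravariant tensor field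
`Φ_0 + ⋯ + Φ_N` (with `Φ_r` homogeneous of order `r`):
`f ↦ ∑ r, (-iħ)^r ⟨Φ_r, ∇^r_sym f⟩`. -/
def directQuantization [FiniteDimensional ℝ E]
    (cov : CovariantDerivative 𝓘(ℝ, E) E (TangentSpace 𝓘(ℝ, E) : M → Type _))
    (ħ : ℝ) (N : ℕ) (Φ : ∀ (r : ℕ) (x : M), ContraTensor E r x) (f : M → ℂ) (x : M) : ℂ :=
  ∑ r ∈ Finset.range (N + 1), (-Complex.I * ħ) ^ r * contract (Φ r x) (cov.symCovDifferential r f x)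

/-- The quantization by the exponential map, for the contravariant tensor field `Φ_0 + ⋯ + Φ_N`:
on each fibre `T_x M`, the tensor `Φ_r(x)`, as a constant tensor field on the vector space `T_x M`,
is quantized there and applied to `f ∘ exp` at the origin. -/
def expQuantization
    (cov : CovariantDerivative 𝓘(ℝ, E) E (TangentSpace 𝓘(ℝ, E) : M → Type _))
    (ħ : ℝ) (N : ℕ) (Φ : ∀ (r : ℕ) (x : M), ContraTensor E r x) (f : M → ℂ) (x : M) : ℂ :=
  ∑ r ∈ Finset.range (N + 1), (-Complex.I * ħ) ^ r * contract (Φ r x) (cov.expDifferential r f x)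

end CovariantDerivative

end

/-! For small `t` the curve `t ↦ exp (t v)` is the geodesic `c` with initial velocity `v`
(`expMap_smul`, from the quadratic homogeneity of the geodesic equation). Since `ċ` is parallel
along `c`, the derivative of `T(ċ, …, ċ)` is `(∇T)(ċ, …, ċ)` (`hasDerivAt_tensor_geodesic`).
Iterating from `f`, the `r`-th derivative of `f ∘ c` at `0` is `∇^r f (v, …, v)`
(`iteratedDeriv_comp_geodesic`); it is also the `r`-th differential of `f ∘ exp` at `0` on `(v, …,
v)`. That differential is symmetric, and a symmetric form is determined by its diagonal, so it is
the symmetrization of `∇^r f` (`iteratedFDeriv_eq_of_diagonal`). The two quantizations then agree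
term by term.

Two things must be supplied for this.

The analysis: geodesics with small initial velocity exist on an interval around `[0, 1]` and depend
smoothly on that velocity. `exists_contDiffAt_quadratic_flow` writes the geodesic equation in a
chart as an equation in the Banach space of continuous curves. The nonlinearity is quadratic in the
velocity, so the linearization at the zero velocity is the identity and the inverse function theorem
applies.

The coordinates: the geodesic field and `∇T` are defined at each point through the preferred chart
of that very point, a choice that varies with the point without any continuity. The transformation
law `toCoord_christoffel` moves everything to a fixed chart; the second derivatives of the
transition map cancel, both in the geodesic field (`tangentCoordChange_geodesicField`) and in `∇T`
(`tensorInChart_covDifferential`). This gives the smoothness of the field, hence uniqueness of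
geodesics, and the smoothness of all `∇^r f`. -/

noncomputable section

namespace ContinuousMap

/-! ### Smoothness of substitution operators on spaces of continuous functions -/

section Nemytskii

set_option synthInstance.maxHeartbeats 200000

universe u
variable {K : Type*} [TopologicalSpace K] [CompactSpace K]
  {E F : Type u} [NormedAddCommGroup E] [NormedSpace ℝ E] [NormedAddCommGroup F] [NormedSpace ℝ F]

/-- Pointwise application of a continuous bilinear map to continuous functions. -/
def bilinL {A : Type*} [NormedAddCommGroup A] [NormedSpace ℝ A] (B : A →L[ℝ] E →L[ℝ] F) :
    C(K, A) →L[ℝ] C(K, E) →L[ℝ] C(K, F) :=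
  LinearMap.mkContinuous₂
    (LinearMap.mk₂ ℝ (fun (a : C(K, A)) (h : C(K, E)) =>
        (⟨fun t => B (a t) (h t), (B.continuous.comp a.continuous).clm_apply h.continuous⟩ :
          C(K, F)))
      (fun _ _ _ => by ext; simp) (fun _ _ _ => by ext; simp)
      (fun _ _ _ => by ext; simp) (fun _ _ _ => by ext; simp)) ‖B‖
    (fun a h => by
      refine (ContinuousMap.norm_le _ (by positivity)).2 fun t => ?_
      refine (B.le_opNorm₂ _ _).trans ?_
      gcongr
      · exact a.norm_coe_le_norm t
      · exact h.norm_coe_le_norm t)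

instance operatorNormedAddCommGroup : NormedAddCommGroup C(K, E →L[ℝ] F) :=
  ContinuousMap.instNormedAddCommGroup

instance operatorNormedSpace : NormedSpace ℝ C(K, E →L[ℝ] F) :=
  ContinuousMap.normedSpace

variable (K E F) in
/-- Pointwise application of operator-valued continuous functions to vector-valued ones. -/
def clmApplyL : C(K, E →L[ℝ] F) →L[ℝ] C(K, E) →L[ℝ] C(K, F) :=
  bilinL (ContinuousLinearMap.id ℝ (E →L[ℝ] F))

/-- The mean value inequality at each `t`, with a bound uniform in `t`: the uniformity is the
continuity of `γ ↦ f' ∘ γ` for the sup norm. -/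
lemma hasFDerivAt_postcomp {f : E → F} {f' : E → E →L[ℝ] F} (hf : ∀ z, HasFDerivAt f (f' z) z)
    (hc : Continuous f) (hf' : Continuous f') (γ : C(K, E)) :
    HasFDerivAt (fun γ : C(K, E) => (⟨f, hc⟩ : C(E, F)).comp γ)
      (clmApplyL K E F ((⟨f', hf'⟩ : C(E, E →L[ℝ] F)).comp γ)) γ := by
  rw [hasFDerivAt_iff_isLittleO_nhds_zero, Asymptotics.isLittleO_iff]
  intro ε hε
  have hcont := (continuous_postcomp (X := K) (⟨f', hf'⟩ : C(E, E →L[ℝ] F))).continuousAt (x := γ)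
  obtain ⟨δ, hδ, H⟩ := Metric.continuousAt_iff.1 hcont ε hε
  filter_upwards [Metric.ball_mem_nhds (0 : C(K, E)) hδ] with h hh
  rw [mem_ball_zero_iff] at hh
  refine (ContinuousMap.norm_le _ (mul_nonneg hε.le (norm_nonneg h))).2 fun t => ?_
  -- Translating the whole curve by the constant `z - γ t` turns closeness of points at time `t`
  -- into closeness of curves, so the radius `δ` does not depend on `t`.
  have bound : ∀ z ∈ Metric.ball (γ t) δ, ‖f' z - f' (γ t)‖ ≤ ε := by
    intro z hz
    have h1 : dist (γ + const K (z - γ t)) γ < δ := by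
      rw [dist_eq_norm, add_sub_cancel_left]
      refine lt_of_le_of_lt ((ContinuousMap.norm_le _ (norm_nonneg (z - γ t))).2 fun _ => le_rfl) ?_
      rwa [← dist_eq_norm]
    have h2 := (norm_coe_le_norm _ t).trans ((dist_eq_norm _ _).symm.trans_le (H h1).le)
    simpa using h2
  have hmem : γ t + h t ∈ Metric.ball (γ t) δ := by
    rw [mem_ball_iff_norm, add_sub_cancel_left]
    exact (h.norm_coe_le_norm t).trans_lt hh
  have := (convex_ball (γ t) δ).norm_image_sub_le_of_norm_hasFDerivWithin_le'
    (fun z _ => (hf z).hasFDerivWithinAt) bound (Metric.mem_ball_self hδ) hmem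
  rw [add_sub_cancel_left] at this
  calc _ = ‖f (γ t + h t) - f (γ t) - f' (γ t) (h t)‖ := rfl
    _ ≤ ε * ‖h t‖ := this
    _ ≤ ε * ‖h‖ := by gcongr; exact h.norm_coe_le_norm t

/-- Composition with a smooth function is smooth on spaces of continuous functions on a compact
space. -/
lemma contDiff_postcomp {f : E → F} (hf : ContDiff ℝ ∞ f) :
    ContDiff ℝ ∞ (fun γ : C(K, E) => (⟨f, hf.continuous⟩ : C(E, F)).comp γ) := by
  rw [contDiff_infty]
  intro n
  -- Each derivative replaces the target `F` by `E →L[ℝ] F`; keeping `E` and `F` in one universe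
  -- lets the induction hypothesis apply to it.
  induction n generalizing F with
  | zero => exact contDiff_zero.2 (continuous_postcomp _)
  | succ n ih =>
    have hf' : ContDiff ℝ ∞ (fderiv ℝ f) := hf.fderiv_right (by simp)
    have hd : ∀ z, HasFDerivAt f (fderiv ℝ f z) z :=
      fun z => (hf.differentiable (by simp) z).hasFDerivAt
    rw [Nat.cast_succ, contDiff_succ_iff_hasFDerivAt]
    exact ⟨_, (clmApplyL K E F).contDiff.comp (ih hf'),
      hasFDerivAt_postcomp hd hf.continuous hf'.continuous⟩

lemma contDiff_clmApplyL {X : Type*} [NormedAddCommGroup X] [NormedSpace ℝ X]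
    {A : X → C(K, E →L[ℝ] F)} (hA : ContDiff ℝ ∞ A) :
    ContDiff ℝ ∞ fun x => clmApplyL K E F (A x) :=
  (clmApplyL K E F).contDiff.comp hA

/-- The linear operator `h ↦ g(z₀ + J w)(w, h)`. -/
def quadraticOperator {g : E → E →L[ℝ] E →L[ℝ] F} (hg : ContDiff ℝ ∞ g) (z₀ : E)
    (J : C(K, E) →L[ℝ] C(K, E)) (w : C(K, E)) : C(K, E) →L[ℝ] C(K, F) :=
  clmApplyL K E F (clmApplyL K E (E →L[ℝ] F)
    ((⟨g, hg.continuous⟩ : C(E, E →L[ℝ] E →L[ℝ] F)).comp (const K z₀ + J w)) w)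

lemma contDiff_quadraticOperator {g : E → E →L[ℝ] E →L[ℝ] F} (hg : ContDiff ℝ ∞ g) (z₀ : E)
    (J : C(K, E) →L[ℝ] C(K, E)) : ContDiff ℝ ∞ (quadraticOperator hg z₀ J) := by
  refine contDiff_clmApplyL (ContDiff.clm_apply (contDiff_clmApplyL ?_) contDiff_id)
  exact (contDiff_postcomp hg).comp (contDiff_const.add J.contDiff)

lemma quadraticOperator_zero {g : E → E →L[ℝ] E →L[ℝ] F} (hg : ContDiff ℝ ∞ g) (z₀ : E)
    (J : C(K, E) →L[ℝ] C(K, E)) : quadraticOperator hg z₀ J 0 = 0 := by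
  ext; simp [quadraticOperator]

end Nemytskii

/-! ### The primitive as a bounded operator on continuous functions -/

section Primitive

variable {E : Type*} [NormedAddCommGroup E] [NormedSpace ℝ E] {a b : ℝ}

omit [NormedSpace ℝ E] in
lemma continuous_IccExtend' (h : a ≤ b) (u : C(Icc a b, E)) : Continuous (Set.IccExtend h u) :=
  u.continuous.Icc_extend'

/-- The primitive vanishing at `0` of a continuous function on `[a, b] ∋ 0`. -/
def primitiveL (h : a ≤ b) : C(Icc a b, E) →L[ℝ] C(Icc a b, E) :=
  LinearMap.mkContinuous
    { toFun := fun u => ⟨fun t => ∫ s in (0 : ℝ)..t, Set.IccExtend h u s,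
        (intervalIntegral.continuous_primitive
          (fun _ _ => (continuous_IccExtend' h u).intervalIntegrable _ _) 0).comp
          continuous_subtype_val⟩
      map_add' := fun u v => by
        ext t
        exact intervalIntegral.integral_add ((continuous_IccExtend' h u).intervalIntegrable _ _)
          ((continuous_IccExtend' h v).intervalIntegrable _ _)
      map_smul' := fun r u => by
        ext t
        exact intervalIntegral.integral_smul r _ } (max |a| |b|)
    (fun u => by
      refine (ContinuousMap.norm_le _ (by positivity)).2 fun t => ?_
      have := intervalIntegral.norm_integral_le_of_norm_le_const (a := 0) (b := (t : ℝ))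
        (f := Set.IccExtend h u) (C := ‖u‖) (fun s _ => u.norm_coe_le_norm _)
      refine this.trans ?_
      rw [mul_comm, sub_zero]
      gcongr
      exact abs_le_max_abs_abs t.2.1 t.2.2)

lemma primitiveL_apply (h : a ≤ b) (u : C(Icc a b, E)) (t : Icc a b) :
    primitiveL h u t = ∫ s in (0 : ℝ)..t, Set.IccExtend h u s := rfl

lemma hasDerivAt_IccExtend_primitiveL [CompleteSpace E] (h : a ≤ b) (u : C(Icc a b, E)) {t : ℝ}
    (ht : t ∈ Ioo a b) :
    HasDerivAt (Set.IccExtend h (primitiveL h u)) (Set.IccExtend h u t) t := by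
  have h1 : HasDerivAt (fun t => ∫ s in (0 : ℝ)..t, Set.IccExtend h u s) (Set.IccExtend h u t) t :=
    intervalIntegral.integral_hasDerivAt_right
      ((continuous_IccExtend' h u).intervalIntegrable _ _)
      ((continuous_IccExtend' h u).stronglyMeasurableAtFilter _ _)
      (continuous_IccExtend' h u).continuousAt
  refine h1.congr_of_eventuallyEq ?_
  filter_upwards [isOpen_Ioo.mem_nhds ht] with s hs
  rw [IccExtend_of_mem h _ (Ioo_subset_Icc_self hs)]
  rfl

end Primitive

end ContinuousMap

/-! ### The second order equation, solved by the inverse function theorem -/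

section SecondOrder

set_option synthInstance.maxHeartbeats 200000

open ContinuousMap

set_option maxHeartbeats 1000000 in
/-- Local existence and smooth dependence on the initial velocity for the second order equation
`ξ'' = -g(ξ)(ξ', ξ')`. -/
theorem exists_contDiffAt_quadratic_flow {E : Type*} [NormedAddCommGroup E] [NormedSpace ℝ E]
    [CompleteSpace E] {g : E → E →L[ℝ] E →L[ℝ] E} (hg : ContDiff ℝ ∞ g) (z₀ : E) :
    ∃ ξ u : E → ℝ → E, ContDiffAt ℝ ∞ (fun v => ξ v 1) 0 ∧ ξ 0 1 = z₀ ∧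
      (∀ N ∈ 𝓝 z₀, ∀ᶠ v in 𝓝 (0 : E), ∀ t ∈ Ioo (-1 : ℝ) 2, ξ v t ∈ N) ∧
      ∀ᶠ v in 𝓝 (0 : E), ξ v 0 = z₀ ∧ u v 0 = v ∧ ∀ t ∈ Ioo (-1 : ℝ) 2,
        HasDerivAt (ξ v) (u v t) t ∧ HasDerivAt (u v) (-g (ξ v t) (u v t) (u v t)) t := by
  -- Any compact interval with `[0, 1]` in its interior would do: the solution is needed on an open
  -- interval around `[0, 1]`.
  have hI : (-1 : ℝ) ≤ 2 := by norm_num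
  let K := Icc (-1 : ℝ) 2
  let i0 : K := ⟨0, by norm_num, by norm_num⟩
  let i1 : K := ⟨1, by norm_num, by norm_num⟩
  let J : C(K, E) →L[ℝ] C(K, E) := primitiveL hI
  let P : C(K, E) → C(K, E) →L[ℝ] C(K, E) := quadraticOperator hg z₀ J
  have hP : ContDiff ℝ ∞ P := contDiff_quadraticOperator hg z₀ J
  have hP0 : P 0 = 0 := quadraticOperator_zero hg z₀ J
  -- The unknown is the velocity `w`, the position being `z₀ + J w`. The integrated equation with
  -- initial velocity `v` reads `H w = v`, with `v` seen as a constant curve.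
  let H : C(K, E) → C(K, E) := fun w => w + J (P w w)
  have hH : ContDiff ℝ ∞ H := contDiff_id.add (J.contDiff.comp (hP.clm_apply contDiff_id))
  have hH0 : H 0 = 0 := by simp [H]
  -- The nonlinear term is `P w w` with `P 0 = 0`, so it contributes nothing at first order.
  have hH' : HasFDerivAt H ((ContinuousLinearEquiv.refl ℝ C(K, E) : C(K, E) ≃L[ℝ] C(K, E)) :
      C(K, E) →L[ℝ] C(K, E)) 0 := by
    have h1 := ((hP.differentiable (by simp) 0).hasFDerivAt).clm_apply (hasFDerivAt_id (0 : C(K, E)))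
    have h2 := (hasFDerivAt_id (0 : C(K, E))).add (J.hasFDerivAt.comp 0 h1)
    refine h2.congr_fderiv ?_
    ext w : 1
    simp [hP0]
  have hHs : HasStrictFDerivAt H ((ContinuousLinearEquiv.refl ℝ C(K, E) : C(K, E) ≃L[ℝ] C(K, E)) :
      C(K, E) →L[ℝ] C(K, E)) 0 := hH.contDiffAt.hasStrictFDerivAt' hH' (by simp)
  let S : C(K, E) → C(K, E) := hHs.localInverse H _ 0
  have hS : ContDiffAt ℝ ∞ S 0 := by
    have := hH.contDiffAt.to_localInverse hH' (by simp)
    rwa [hH0] at this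
  have hSr : ∀ᶠ w in 𝓝 (0 : C(K, E)), H (S w) = w := by
    have := hHs.eventually_right_inverse
    rwa [hH0] at this
  have hS0 : S 0 = 0 := by
    have := hHs.localInverse_apply_image
    rwa [hH0] at this
  let c : E →L[ℝ] C(K, E) := ContinuousLinearMap.const ℝ K
  have hc : ∀ v t, c v t = v := fun _ _ => rfl
  let w : E → C(K, E) := fun v => S (c v)
  have hw : ContDiffAt ℝ ∞ w 0 := by
    have : ContDiffAt ℝ ∞ S (c 0) := by rwa [map_zero]
    exact this.comp 0 c.contDiff.contDiffAt
  have hw0 : w 0 = 0 := by simp only [w, map_zero, hS0]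
  have hwH : ∀ᶠ v in 𝓝 (0 : E), H (w v) = c v := by
    have : Filter.Tendsto c (𝓝 0) (𝓝 0) := by simpa using c.continuous.tendsto 0
    exact this.eventually hSr
  let Ξ : E → C(K, E) := fun v => const K z₀ + J (w v)
  have hΞ : ContDiffAt ℝ ∞ Ξ 0 := contDiffAt_const.add (J.contDiff.contDiffAt.comp 0 hw)
  have hJ0 : ∀ q, J q i0 = 0 := fun q => (primitiveL_apply hI q i0).trans (by simp [i0])
  refine ⟨fun v => Set.IccExtend hI (Ξ v), fun v => Set.IccExtend hI (w v), ?_, ?_, ?_, ?_⟩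
  · have h1 : (fun v => Set.IccExtend hI (Ξ v) 1) = fun v => ContinuousMap.evalCLM ℝ i1 (Ξ v) := by
      funext v; exact IccExtend_of_mem hI _ i1.2
    rw [h1]
    exact (ContinuousMap.evalCLM ℝ i1).contDiff.contDiffAt.comp 0 hΞ
  · refine (IccExtend_of_mem hI _ i1.2).trans ?_
    simp [Ξ, hw0]
  · intro N hN
    obtain ⟨δ, hδ, hN⟩ := Metric.mem_nhds_iff.1 hN
    -- Continuity in the sup norm at the constant solution `z₀` confines the whole curve to `N` at
    -- once.
    have := hΞ.continuousAt.eventually (Metric.ball_mem_nhds _ hδ)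
    filter_upwards [this] with v hv t ht
    apply hN
    have e : (Ξ 0) (projIcc _ _ hI t) = z₀ := by simp [Ξ, hw0]
    rw [← e]
    exact (ContinuousMap.dist_apply_le_dist _).trans_lt hv
  · filter_upwards [hwH] with v hv
    have hv' : ∀ t : K, w v t = v - J (P (w v) (w v)) t := fun t => by
      have := DFunLike.congr_fun hv t
      rw [hc] at this
      exact eq_sub_of_add_eq this
    refine ⟨?_, ?_, fun t ht => ⟨?_, ?_⟩⟩
    · rw [IccExtend_of_mem hI _ i0.2]
      change z₀ + J (w v) i0 = z₀
      rw [hJ0, add_zero]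
    · rw [IccExtend_of_mem hI _ i0.2]
      exact (hv' i0).trans (by rw [hJ0, sub_zero])
    · exact (hasDerivAt_IccExtend_primitiveL hI (w v) ht).const_add z₀
    · have h1 := (hasDerivAt_IccExtend_primitiveL hI (P (w v) (w v)) ht).const_sub v
      have e : Set.IccExtend hI (w v) = fun t => v - Set.IccExtend hI (J (P (w v) (w v))) t :=
        funext fun t => hv' _
      rw [← e] at h1
      exact h1

end SecondOrder

/-! ### Tangent vectors and Christoffel symbols in a fixed chart -/

namespace CovariantDerivative

variable {E : Type*} [NormedAddCommGroup E] [NormedSpace ℝ E]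
  {M : Type*} [TopologicalSpace M] [ChartedSpace E M] [IsManifold 𝓘(ℝ, E) ∞ M]

/-- The components of tangent vectors at `y` in the preferred chart at `x`. -/
def toCoord (x y : M) : TangentSpace 𝓘(ℝ, E) y →L[ℝ] E :=
  (trivializationAt E (TangentSpace 𝓘(ℝ, E) : M → Type _) x).continuousLinearMapAt ℝ y

/-- The tangent vectors at `y` with given components in the preferred chart at `x`. -/
def ofCoord (x y : M) : E →L[ℝ] TangentSpace 𝓘(ℝ, E) y :=
  (trivializationAt E (TangentSpace 𝓘(ℝ, E) : M → Type _) x).symmL ℝ y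

lemma constField_eq_ofCoord (x y : M) (w : E) : constField x w y = ofCoord x y w := rfl

lemma toCoord_ofCoord {x y : M} (hy : y ∈ (chartAt E x).source) (w : E) :
    toCoord x y (ofCoord x y w) = w :=
  Trivialization.continuousLinearMapAt_symmL _ hy w

lemma ofCoord_toCoord {x y : M} (hy : y ∈ (chartAt E x).source) (v : TangentSpace 𝓘(ℝ, E) y) :
    ofCoord x y (toCoord x y v) = v :=
  Trivialization.symmL_continuousLinearMapAt _ hy v

lemma ofCoord_self (x : M) (w : E) : ofCoord x x w = w := constField_self x w

lemma toCoord_self (x : M) (w : E) : toCoord x x w = w := by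
  have h := toCoord_ofCoord (mem_chart_source E x) w
  rwa [ofCoord_self] at h

lemma trivializationAt_snd_eq_toCoord {x : M} (p : TangentBundle 𝓘(ℝ, E) M)
    (hp : p.1 ∈ (chartAt E x).source) :
    (trivializationAt E (TangentSpace 𝓘(ℝ, E) : M → Type _) x p).2 = toCoord x p.1 p.2 := by
  unfold toCoord
  rw [Trivialization.continuousLinearMapAt_apply, Trivialization.linearMapAt_apply]
  exact (if_pos hp).symm

lemma toCoord_ofCoord_eq_tangentCoordChange {x y z : M} (hx : z ∈ (chartAt E x).source)
    (hy : z ∈ (chartAt E y).source) (w : E) :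
    toCoord x z (ofCoord y z w) = tangentCoordChange 𝓘(ℝ, E) y x z w := by
  unfold toCoord ofCoord
  rw [TangentBundle.continuousLinearMapAt_trivializationAt_eq_core hx,
    TangentBundle.symmL_trivializationAt_eq_core hy]
  exact (tangentBundleCore 𝓘(ℝ, E) M).coordChange_comp _ _ _ _
    ⟨⟨hy, mem_chart_source E z⟩, hx⟩ w

lemma ofCoord_tangentCoordChange {x y z : M} (hx : z ∈ (chartAt E x).source)
    (hy : z ∈ (chartAt E y).source) (w : E) :
    ofCoord x z (tangentCoordChange 𝓘(ℝ, E) y x z w) = ofCoord y z w := by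
  rw [← toCoord_ofCoord_eq_tangentCoordChange hx hy, ofCoord_toCoord hx]

lemma tangentCoordChange_eq_toCoord {x y : M} (hx : y ∈ (chartAt E x).source) (w : E) :
    tangentCoordChange 𝓘(ℝ, E) y x y w = toCoord x y (w : TangentSpace 𝓘(ℝ, E) y) := by
  rw [← toCoord_ofCoord_eq_tangentCoordChange hx (mem_chart_source E y), ofCoord_self]

lemma contMDiffAt_constField {x y : M} (hy : y ∈ (chartAt E x).source) (w : E) :
    ContMDiffAt 𝓘(ℝ, E) 𝓘(ℝ, E).tangent ∞
      (fun y => (⟨y, constField x w y⟩ : TangentBundle 𝓘(ℝ, E) M)) y := by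
  let e := trivializationAt E (TangentSpace 𝓘(ℝ, E) : M → Type _) x
  refine (e.contMDiffAt_section_iff hy).2 ?_
  refine (contMDiffAt_const (c := w)).congr_of_eventuallyEq ?_
  filter_upwards [(chartAt E x).open_source.mem_nhds hy] with z hz
  rw [trivializationAt_snd_eq_toCoord _ hz]
  exact toCoord_ofCoord hz w

lemma mdifferentiableAt_constField' {x y : M} (hy : y ∈ (chartAt E x).source) (w : E) :
    MDifferentiableAt 𝓘(ℝ, E) 𝓘(ℝ, E).tangent
      (fun y => (⟨y, constField x w y⟩ : TangentBundle 𝓘(ℝ, E) M)) y :=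
  (contMDiffAt_constField hy w).mdifferentiableAt (by simp)

/-- The change of coordinates from the preferred chart at `y` to the one at `x`. -/
def transition (x y : M) : E → E := extChartAt 𝓘(ℝ, E) x ∘ (extChartAt 𝓘(ℝ, E) y).symm

lemma contDiffAt_transition {x y z : M} (hx : z ∈ (chartAt E x).source)
    (hy : z ∈ (chartAt E y).source) :
    ContDiffAt ℝ ∞ (transition x y) (extChartAt 𝓘(ℝ, E) y z) := by
  rw [← extChartAt_source 𝓘(ℝ, E)] at hx hy
  have h := contDiffWithinAt_ext_coord_change (I := 𝓘(ℝ, E)) (n := ∞) x y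
    (y := extChartAt 𝓘(ℝ, E) y z) (by
      rw [PartialEquiv.trans_source'', PartialEquiv.symm_symm, PartialEquiv.symm_target]
      exact mem_image_of_mem _ ⟨hy, hx⟩)
  rwa [ModelWithCorners.range_eq_univ, contDiffWithinAt_univ] at h

omit [IsManifold 𝓘(ℝ, E) ∞ M] in
lemma transition_apply {x y z : M} (hy : z ∈ (chartAt E y).source) :
    transition x y (extChartAt 𝓘(ℝ, E) y z) = extChartAt 𝓘(ℝ, E) x z := by
  rw [transition, Function.comp_apply, (extChartAt 𝓘(ℝ, E) y).left_inv (by rwa [extChartAt_source])]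

lemma tangentCoordChange_eq_fderiv (x y z : M) :
    tangentCoordChange 𝓘(ℝ, E) y x z = fderiv ℝ (transition x y) (extChartAt 𝓘(ℝ, E) y z) := by
  rw [tangentCoordChange_def, ModelWithCorners.range_eq_univ, fderivWithin_univ]
  rfl

/-- The tangent space at `y` is identified with `E` through the preferred chart at `y` itself, so
this chart has the identity as derivative at `y`. -/
lemma hasMFDerivAt_extChartAt_self (y : M) :
    HasMFDerivAt 𝓘(ℝ, E) 𝓘(ℝ, E) (extChartAt 𝓘(ℝ, E) y) y
      (ContinuousLinearMap.id ℝ E : TangentSpace 𝓘(ℝ, E) y →L[ℝ] E) := by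
  refine (hasMFDerivAt_extChartAt (I := 𝓘(ℝ, E)) (mem_chart_source E y)).congr_mfderiv ?_
  rw [mfderiv_chartAt_eq_tangentCoordChange (mem_chart_source E y)]
  ext v
  exact tangentCoordChange_self (mem_extChartAt_source y)

lemma hasMFDerivAt_comp_extChartAt_self {G : Type*} [NormedAddCommGroup G] [NormedSpace ℝ G]
    {y : M} {f : E → G} {f' : E →L[ℝ] G} (hf : HasFDerivAt f f' (extChartAt 𝓘(ℝ, E) y y)) :
    HasMFDerivAt 𝓘(ℝ, E) 𝓘(ℝ, G) (fun z => f (extChartAt 𝓘(ℝ, E) y z)) y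
      (f' : TangentSpace 𝓘(ℝ, E) y →L[ℝ] G) :=
  hf.hasMFDerivAt.comp y (hasMFDerivAt_extChartAt_self y)

lemma hasFDerivAt_fderiv_transition_apply {x y : M} (hy : y ∈ (chartAt E x).source) (w : E) :
    HasFDerivAt (fun a => fderiv ℝ (transition x y) a w)
      ((fderiv ℝ (fderiv ℝ (transition x y)) (extChartAt 𝓘(ℝ, E) y y)).flip w)
      (extChartAt 𝓘(ℝ, E) y y) := by
  have h := contDiffAt_transition hy (mem_chart_source E y)
  have h1 : DifferentiableAt ℝ (fderiv ℝ (transition x y)) (extChartAt 𝓘(ℝ, E) y y) :=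
    (h.fderiv_right (m := 1) (by norm_cast)).differentiableAt (by simp)
  exact (h1.hasFDerivAt.clm_apply (hasFDerivAt_const w _)).congr_fderiv (by ext; simp)

section Coordinates

variable [FiniteDimensional ℝ E]
  (cov : CovariantDerivative 𝓘(ℝ, E) E (TangentSpace 𝓘(ℝ, E) : M → Type _))

/-- The Christoffel symbols at `y` in the preferred chart at `x`; the first argument is the
differentiated field and the second one is the direction. -/
def chartChristoffel (x y : M) : E →L[ℝ] E →L[ℝ] E :=
  ∑ i, (LinearMap.toContinuousLinearMap ((Module.finBasis ℝ E).coord i)).smulRight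
    (toCoord x y ∘L cov (constField x (Module.finBasis ℝ E i)) y ∘L ofCoord x y)

lemma chartChristoffel_apply (x y : M) (w v : E) : cov.chartChristoffel x y w v =
    ∑ i, (Module.finBasis ℝ E).repr w i •
      toCoord x y (cov (constField x (Module.finBasis ℝ E i)) y (ofCoord x y v)) := by
  simp [chartChristoffel]

omit [FiniteDimensional ℝ E] in
variable {cov} in
lemma cov_sum {ι : Type*} (s : Finset ι)
    {σ : ι → Π y : M, TangentSpace 𝓘(ℝ, E) y} {y : M}
    (hσ : ∀ i ∈ s, MDifferentiableAt 𝓘(ℝ, E) 𝓘(ℝ, E).tangent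
      (fun y => (⟨y, σ i y⟩ : TangentBundle 𝓘(ℝ, E) M)) y) :
    cov (fun y => ∑ i ∈ s, σ i y) y = ∑ i ∈ s, cov (σ i) y := by
  classical
  induction s using Finset.induction_on with
  | empty => exact cov.isCovariantDerivativeOnUniv.zero (x := y)
  | insert i s hi ih =>
    have h1 : MDifferentiableAt 𝓘(ℝ, E) 𝓘(ℝ, E).tangent
        (fun y => (⟨y, ∑ i ∈ s, σ i y⟩ : TangentBundle 𝓘(ℝ, E) M)) y := by
      exact MDifferentiableAt.sum_section (fun i hi => hσ i (Finset.mem_insert_of_mem hi))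
    have h2 := cov.isCovariantDerivativeOnUniv.add (x := y) (hσ i (Finset.mem_insert_self _ _)) h1
    rw [Finset.sum_insert hi, ← ih fun i hi => hσ i (Finset.mem_insert_of_mem hi), ← h2]
    congr 1
    funext z
    simp [Finset.sum_insert hi]

/-- The covariant derivative of a vector field, in terms of its components in a chart. -/
lemma cov_ofCoord {x y : M} (hy : y ∈ (chartAt E x).source) {a : M → E}
    (ha : MDifferentiableAt 𝓘(ℝ, E) 𝓘(ℝ, E) a y) (v : TangentSpace 𝓘(ℝ, E) y) :
    cov (fun z => ofCoord x z (a z)) y v =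
      ofCoord x y (mvfderiv 𝓘(ℝ, E) a y v + cov.chartChristoffel x y (a y) (toCoord x y v)) := by
  let b := Module.finBasis ℝ E
  let L := fun i => LinearMap.toContinuousLinearMap (b.coord i)
  have hL : ∀ i, HasMFDerivAt 𝓘(ℝ, E) 𝓘(ℝ, ℝ) (fun z => L i (a z)) y
      ((L i).comp (mvfderiv 𝓘(ℝ, E) a y)) := fun i =>
    ((L i).hasMFDerivAt (x := a y)).comp y ha.hasMFDerivAt
  -- Expanding the components in a basis of `E` reduces the claim to additivity and the Leibniz rule
  -- for constant-component fields.
  have e : (fun z => ofCoord x z (a z)) =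
      fun z => ∑ i, ((fun z => L i (a z)) • constField x (b i)) z := by
    funext z
    conv_lhs => rw [← b.sum_repr (a z)]
    rw [map_sum]
    refine Finset.sum_congr rfl fun i _ => ?_
    rw [map_smul]
    rfl
  have hs : ∀ i, MDifferentiableAt 𝓘(ℝ, E) 𝓘(ℝ, E).tangent
      (fun z => (⟨z, ((fun z => L i (a z)) • constField x (b i)) z⟩ :
        TangentBundle 𝓘(ℝ, E) M)) y := fun i =>
    (hL i).mdifferentiableAt.smul_section (mdifferentiableAt_constField' hy (b i))
  rw [e, cov_sum _ fun i _ => hs i]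
  have hl : ∀ i, cov ((fun z => L i (a z)) • constField x (b i)) y v =
      b.repr (a y) i • cov (constField x (b i)) y v +
        b.repr (mvfderiv 𝓘(ℝ, E) a y v) i • ofCoord x y (b i) := fun i => by
    rw [cov.isCovariantDerivativeOnUniv.leibniz (mdifferentiableAt_constField' hy (b i))
      (hL i).mdifferentiableAt]
    have h3 : mvfderiv 𝓘(ℝ, E) (fun z => L i (a z)) y v = L i (mvfderiv 𝓘(ℝ, E) a y v) :=
      congrArg (fun A => A v) (hL i).mfderiv
    rw [_root_.add_apply, ContinuousLinearMap.smulRight_apply, h3]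
    rfl
  rw [_root_.sum_apply, Finset.sum_congr rfl fun i _ => hl i, Finset.sum_add_distrib, add_comm,
    map_add, chartChristoffel_apply]
  congr 1
  · conv_rhs => rw [← b.sum_repr (mvfderiv 𝓘(ℝ, E) a y v), map_sum]
    simp only [map_smul]
  · rw [map_sum]
    refine Finset.sum_congr rfl fun i _ => ?_
    rw [map_smul, ofCoord_toCoord hy, ofCoord_toCoord hy]

/-- The transformation law of the Christoffel symbols. -/
lemma toCoord_christoffel {x y : M} (hy : y ∈ (chartAt E x).source)
    (v w : E) :
    toCoord x y (cov.christoffel y v w) =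
      fderiv ℝ (fderiv ℝ (transition x y)) (extChartAt 𝓘(ℝ, E) y y) v w +
      cov.chartChristoffel x y (toCoord x y w) (toCoord x y v) := by
  -- A field constant in the chart at `y` has, in the chart at `x`, components given by the Jacobian
  -- of the transition applied to `w`; differentiating them produces the second derivative.
  let a : M → E := fun z => fderiv ℝ (transition x y) (extChartAt 𝓘(ℝ, E) y z) w
  have ha := hasMFDerivAt_comp_extChartAt_self (hasFDerivAt_fderiv_transition_apply hy w)
  have hay : a y = toCoord x y w := by
    rw [← tangentCoordChange_eq_toCoord hy, tangentCoordChange_eq_fderiv]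
  have e : ∀ᶠ z in 𝓝 y, constField y w z = ofCoord x z (a z) := by
    filter_upwards [(chartAt E x).open_source.mem_nhds hy, chart_source_mem_nhds E y] with z hx hz
    rw [constField_eq_ofCoord, ← ofCoord_tangentCoordChange hx hz, tangentCoordChange_eq_fderiv]
  have hs := mdifferentiableAt_constField y w
  have hs' : MDifferentiableAt 𝓘(ℝ, E) 𝓘(ℝ, E).tangent
      (fun z => (⟨z, ofCoord x z (a z)⟩ : TangentBundle 𝓘(ℝ, E) M)) y :=
    hs.congr_of_eventuallyEq (e.mono fun z hz => by simp only [hz])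
  have h := cov.isCovariantDerivativeOnUniv.congr_of_eventuallyEq hs hs' Filter.univ_mem e
  have hc := congrArg (toCoord x y) ((congrArg (fun A => A v) h).trans
    (cov.cov_ofCoord hy (a := a) ha.mdifferentiableAt v))
  rw [toCoord_ofCoord hy, hay] at hc
  refine hc.trans ?_
  congr 1
  exact congrArg (fun A => A v) ha.mfderiv

variable [T2Space M] [CovariantDerivative.ContMDiffCovariantDerivative cov ∞]

/-- Smoothness of the connection is stated for global smooth fields, whereas `constField x w` is
smooth only over the chart domain. It is cut off by a bump function equal to `1` near `y`, which
changes nothing there because the connection is local. -/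
lemma contMDiffAt_cov_constField {x y : M} (hy : y ∈ (chartAt E x).source) (w : E) :
    ContMDiffAt 𝓘(ℝ, E) 𝓘(ℝ, E →L[ℝ] E) ∞
      (fun z => toCoord x z ∘L cov (constField x w) z ∘L ofCoord x z) y := by
  have hnhds := (chartAt E x).open_source.mem_nhds hy
  obtain ⟨ψ, -, hψ⟩ := (SmoothBumpFunction.nhds_basis_tsupport (I := 𝓘(ℝ, E)) y).mem_iff.1 hnhds
  have hσ : ContMDiff 𝓘(ℝ, E) 𝓘(ℝ, E).tangent ∞ (fun z =>
      (⟨z, ((ψ : M → ℝ) • constField x w) z⟩ : TangentBundle 𝓘(ℝ, E) M)) :=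
    ContMDiffOn.smul_section_of_tsupport ψ.contMDiff.contMDiffOn (chartAt E x).open_source hψ
      fun z hz => (contMDiffAt_constField hz w).contMDiffWithinAt
  have hcov := (ContMDiffCovariantDerivative.contMDiff (cov := cov) (k := ∞)).contMDiff
    (σ := (ψ : M → ℝ) • constField x w) (hσ.contMDiffOn.of_le (by simp))
  have hcov' := (hcov y (mem_univ y)).contMDiffAt Filter.univ_mem
  let e := trivializationAt (E →L[ℝ] E)
    (fun z : M => TangentSpace 𝓘(ℝ, E) z →L[ℝ] TangentSpace 𝓘(ℝ, E) z) x
  have h := (e.contMDiffAt_section_iff (by exact ⟨hy, hy⟩)).1 hcov'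
  refine h.congr_of_eventuallyEq ?_
  filter_upwards [hnhds, ψ.eventuallyEq_one.eventuallyEq_nhds] with z hz hz1
  have e1 : ∀ᶠ z' in 𝓝 z, constField x w z' = ((ψ : M → ℝ) • constField x w) z' := by
    filter_upwards [hz1] with z' hz'
    change _ = ψ z' • constField x w z'
    rw [hz', Pi.one_apply, one_smul]
  rw [cov.isCovariantDerivativeOnUniv.congr_of_eventuallyEq (mdifferentiableAt_constField' hz w)
    ((hσ z).mdifferentiableAt (by simp)) Filter.univ_mem e1]
  rfl

set_option synthInstance.maxHeartbeats 200000 in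
lemma contMDiffOn_chartChristoffel (x : M) :
    ContMDiffOn 𝓘(ℝ, E) 𝓘(ℝ, E →L[ℝ] E →L[ℝ] E) ∞ (cov.chartChristoffel x)
      (chartAt E x).source := by
  intro y hy
  refine ContMDiffAt.contMDiffWithinAt ?_
  unfold chartChristoffel
  refine ContMDiffAt.sum fun i _ => ?_
  let L : (E →L[ℝ] E) →L[ℝ] (E →L[ℝ] E →L[ℝ] E) := ContinuousLinearMap.smulRightL ℝ E (E →L[ℝ] E)
    (LinearMap.toContinuousLinearMap ((Module.finBasis ℝ E).coord i))
  have hL : ContDiff ℝ ∞ L := by fun_prop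
  exact hL.contMDiff.contMDiffAt.comp y (cov.contMDiffAt_cov_constField hy _)

end Coordinates

end CovariantDerivative

/-! ### Charts of the tangent bundle and smoothness of the geodesic field -/

namespace CovariantDerivative

variable {E : Type*} [NormedAddCommGroup E] [NormedSpace ℝ E]
  {M : Type*} [TopologicalSpace M] [ChartedSpace E M] [IsManifold 𝓘(ℝ, E) ∞ M]

/-- Needed for the uniqueness of integral curves. Vectors over distinct points are separated in the
base, vectors over the same point by their fibre coordinate in a trivialization. -/
instance t2Space_tangentBundle [T2Space M] : T2Space (TangentBundle 𝓘(ℝ, E) M) := by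
  refine ⟨fun p q hpq => ?_⟩
  by_cases h : p.1 = q.1
  · let e := trivializationAt E (TangentSpace 𝓘(ℝ, E) : M → Type _) p.1
    have hp : p ∈ e.source := e.mem_source.2 (FiberBundle.mem_baseSet_trivializationAt' p.1)
    have hq : q ∈ e.source := e.mem_source.2 (h ▸ FiberBundle.mem_baseSet_trivializationAt' p.1)
    have hne : (e p).2 ≠ (e q).2 := fun h2 =>
      hpq (e.injOn hp hq (Prod.ext ((e.coe_fst hp).trans (h.trans (e.coe_fst hq).symm)) h2))
    obtain ⟨U, V, hU, hV, hpU, hqV, hUV⟩ := t2_separation hne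
    have hc : ContinuousOn (fun z => (e z).2) e.source := continuous_snd.comp_continuousOn e.continuousOn
    refine ⟨_, _, hc.isOpen_inter_preimage e.open_source hU,
      hc.isOpen_inter_preimage e.open_source hV, ⟨hp, hpU⟩, ⟨hq, hqV⟩, ?_⟩
    exact (hUV.preimage _).mono inter_subset_right inter_subset_right
  · obtain ⟨U, V, hU, hV, hpU, hqV, hUV⟩ := t2_separation h
    have hc := FiberBundle.continuous_proj E (TangentSpace 𝓘(ℝ, E) : M → Type _)
    exact ⟨_, _, hU.preimage hc, hV.preimage hc, hpU, hqV, hUV.preimage _⟩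

lemma mem_extChartAt_tangent_source {p q : TangentBundle 𝓘(ℝ, E) M} :
    q ∈ (extChartAt 𝓘(ℝ, E).tangent p).source ↔ q.1 ∈ (chartAt E p.1).source := by
  rw [extChartAt_source, TangentBundle.mem_chart_source_iff]

lemma extChartAt_tangent_apply {p q : TangentBundle 𝓘(ℝ, E) M}
    (hq : q.1 ∈ (chartAt E p.1).source) :
    extChartAt 𝓘(ℝ, E).tangent p q = (extChartAt 𝓘(ℝ, E) p.1 q.1, toCoord p.1 q.1 q.2) := by
  refine Prod.ext rfl ?_
  rw [← trivializationAt_snd_eq_toCoord q hq]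
  rfl

lemma extChartAt_tangent_target {p : TangentBundle 𝓘(ℝ, E) M} :
    (extChartAt 𝓘(ℝ, E).tangent p).target = (extChartAt 𝓘(ℝ, E) p.1).target ×ˢ univ := by
  ext a
  rw [extChartAt_target, extChartAt_target, ModelWithCorners.range_eq_univ,
    ModelWithCorners.range_eq_univ, inter_univ, inter_univ]
  refine Iff.trans (TangentBundle.mem_chart_target_iff (I := 𝓘(ℝ, E)) a p) ?_
  simp

lemma extChartAt_tangent_symm_apply {p : TangentBundle 𝓘(ℝ, E) M} {a : E}
    (ha : a ∈ (extChartAt 𝓘(ℝ, E) p.1).target) (w : E) :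
    (extChartAt 𝓘(ℝ, E).tangent p).symm (a, w) =
      ⟨(extChartAt 𝓘(ℝ, E) p.1).symm a, ofCoord p.1 ((extChartAt 𝓘(ℝ, E) p.1).symm a) w⟩ := by
  have hs : (extChartAt 𝓘(ℝ, E) p.1).symm a ∈ (chartAt E p.1).source := by
    rw [← extChartAt_source 𝓘(ℝ, E)]
    exact (extChartAt 𝓘(ℝ, E) p.1).map_target ha
  have ht : (a, w) ∈ (extChartAt 𝓘(ℝ, E).tangent p).target := by
    rw [extChartAt_tangent_target]; exact ⟨ha, mem_univ _⟩
  refine (extChartAt 𝓘(ℝ, E).tangent p).injOn ((extChartAt 𝓘(ℝ, E).tangent p).map_target ht)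
    (mem_extChartAt_tangent_source.2 hs) ?_
  rw [(extChartAt 𝓘(ℝ, E).tangent p).right_inv ht, extChartAt_tangent_apply hs,
    toCoord_ofCoord hs, (extChartAt 𝓘(ℝ, E) p.1).right_inv ha]

/-- In coordinates the transition of the tangent bundle is `(a, u) ↦ (ψ a, Dψ(a) u)`; this is its
derivative in the direction `(v, η)`. -/
lemma tangentCoordChange_tangent {p q : TangentBundle 𝓘(ℝ, E) M}
    (hp : p.1 ∈ (chartAt E q.1).source) (v η : E) :
    tangentCoordChange 𝓘(ℝ, E).tangent p q p (v, η) =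
      (fderiv ℝ (transition q.1 p.1) (extChartAt 𝓘(ℝ, E) p.1 p.1) v,
        fderiv ℝ (fderiv ℝ (transition q.1 p.1)) (extChartAt 𝓘(ℝ, E) p.1 p.1) v p.2 +
        fderiv ℝ (transition q.1 p.1) (extChartAt 𝓘(ℝ, E) p.1 p.1) η) := by
  have hpp := mem_chart_source E p.1
  have h := contDiffAt_transition hp hpp
  have h1 : DifferentiableAt ℝ (fderiv ℝ (transition q.1 p.1)) (extChartAt 𝓘(ℝ, E) p.1 p.1) :=
    (h.fderiv_right (m := 1) (by norm_cast)).differentiableAt (by simp)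
  obtain ⟨u, hu⟩ : ∃ u : E, p.2 = u := ⟨_, rfl⟩
  have hbase : extChartAt 𝓘(ℝ, E).tangent p p = (extChartAt 𝓘(ℝ, E) p.1 p.1, u) := by
    rw [extChartAt_tangent_apply hpp, hu]
    exact congrArg _ (toCoord_self p.1 u)
  have e : (extChartAt 𝓘(ℝ, E).tangent q ∘ (extChartAt 𝓘(ℝ, E).tangent p).symm)
      =ᶠ[𝓝 (extChartAt 𝓘(ℝ, E) p.1 p.1, u)]
      fun a : E × E => (transition q.1 p.1 a.1, fderiv ℝ (transition q.1 p.1) a.1 a.2) := by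
    have hT : (extChartAt 𝓘(ℝ, E) p.1).target ∩ (extChartAt 𝓘(ℝ, E) p.1).symm ⁻¹'
        (chartAt E q.1).source ∈ 𝓝 (extChartAt 𝓘(ℝ, E) p.1 p.1) := by
      refine Filter.inter_mem (extChartAt_target_mem_nhds p.1) ?_
      exact extChartAt_preimage_mem_nhds ((chartAt E q.1).open_source.mem_nhds hp)
    have hT' := continuous_fst.continuousAt (x := (extChartAt 𝓘(ℝ, E) p.1 p.1, u)) hT
    filter_upwards [hT'] with a ha
    have hs : (extChartAt 𝓘(ℝ, E) p.1).symm a.1 ∈ (chartAt E p.1).source := by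
      rw [← extChartAt_source 𝓘(ℝ, E)]
      exact (extChartAt 𝓘(ℝ, E) p.1).map_target ha.1
    rw [Function.comp_apply, extChartAt_tangent_symm_apply ha.1, extChartAt_tangent_apply ha.2,
      toCoord_ofCoord_eq_tangentCoordChange ha.2 hs, tangentCoordChange_eq_fderiv,
      (extChartAt 𝓘(ℝ, E) p.1).right_inv ha.1]
    rfl
  have hd : HasFDerivAt (fun a : E × E =>
      (transition q.1 p.1 a.1, fderiv ℝ (transition q.1 p.1) a.1 a.2)) _
      (extChartAt 𝓘(ℝ, E) p.1 p.1, u) :=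
    (HasFDerivAt.comp (g := transition q.1 p.1) (f := fun a : E × E => a.1) _
      (h.differentiableAt (by simp)).hasFDerivAt hasFDerivAt_fst).prodMk
    ((HasFDerivAt.comp (g := fderiv ℝ (transition q.1 p.1)) (f := fun a : E × E => a.1) _
      h1.hasFDerivAt hasFDerivAt_fst).clm_apply hasFDerivAt_snd)
  rw [tangentCoordChange_def, ModelWithCorners.range_eq_univ, fderivWithin_univ, hbase, e.fderiv_eq,
    hd.fderiv]
  refine Prod.ext rfl ?_
  simp [add_comm, hu]

section Geodesic

variable [FiniteDimensional ℝ E]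
  (cov : CovariantDerivative 𝓘(ℝ, E) E (TangentSpace 𝓘(ℝ, E) : M → Type _))

/-- The geodesic field in the coordinates given by the preferred chart at `q`. -/
lemma tangentCoordChange_geodesicField {p q : TangentBundle 𝓘(ℝ, E) M}
    (hp : p.1 ∈ (chartAt E q.1).source) :
    tangentCoordChange 𝓘(ℝ, E).tangent p q p (cov.geodesicField p) =
      (toCoord q.1 p.1 p.2,
        -cov.chartChristoffel q.1 p.1 (toCoord q.1 p.1 p.2) (toCoord q.1 p.1 p.2)) := by
  have hA : ∀ w : E, fderiv ℝ (transition q.1 p.1) (extChartAt 𝓘(ℝ, E) p.1 p.1) w =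
      toCoord q.1 p.1 w := fun w => by
    rw [← tangentCoordChange_eq_toCoord hp, tangentCoordChange_eq_fderiv]
  have h := tangentCoordChange_tangent hp p.2 (-cov.christoffel p.1 p.2 p.2)
  have hc := cov.toCoord_christoffel hp p.2 p.2
  refine h.trans (Prod.ext (hA _) ?_)
  -- The term `D²ψ(u, u)` of the bundle transition cancels against the one in the transformation law
  -- of the Christoffel symbols.
  refine (congrArg₂ (· + ·) rfl ((hA _).trans ((map_neg _ _).trans (congrArg Neg.neg hc)))).trans ?_
  simp only [neg_add, add_neg_cancel_left]

variable [T2Space M] [CovariantDerivative.ContMDiffCovariantDerivative cov ∞]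

/-- Near `q` the field is read in the single chart at `q`, where it is `(u, -Γ(u, u))` with smooth
Christoffel symbols. Class `C^1` is what uniqueness of integral curves requires. -/
lemma contMDiff_geodesicField : ContMDiff 𝓘(ℝ, E).tangent 𝓘(ℝ, E).tangent.tangent 1
    (fun p => (⟨p, cov.geodesicField p⟩ :
      TangentBundle 𝓘(ℝ, E).tangent (TangentBundle 𝓘(ℝ, E) M))) := by
  intro q
  refine contMDiffAt_totalSpace.2 ⟨contMDiffAt_id, ?_⟩
  have hsrc : ∀ᶠ p in 𝓝 q, p.1 ∈ (chartAt E q.1).source := by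
    have hc := FiberBundle.continuous_proj E (TangentSpace 𝓘(ℝ, E) : M → Type _)
    exact hc.continuousAt.eventually (chart_source_mem_nhds E q.1)
  have h1 : ContMDiffAt 𝓘(ℝ, E).tangent 𝓘(ℝ, E × E) ∞ (extChartAt 𝓘(ℝ, E).tangent q) q :=
    contMDiffAt_extChartAt
  have hu : ContMDiffAt 𝓘(ℝ, E).tangent 𝓘(ℝ, E) ∞ (fun p => (extChartAt 𝓘(ℝ, E).tangent q p).2) q :=
    (contDiff_snd (𝕜 := ℝ) (E := E) (F := E)).contMDiff.contMDiffAt.comp q h1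
  have hg : ContMDiffAt 𝓘(ℝ, E).tangent 𝓘(ℝ, E →L[ℝ] E →L[ℝ] E) ∞
      (fun p : TangentBundle 𝓘(ℝ, E) M => cov.chartChristoffel q.1 p.1) q :=
    ((cov.contMDiffOn_chartChristoffel q.1).contMDiffAt (chart_source_mem_nhds E q.1)).comp q
      (contMDiffAt_proj _)
  have h2 := hu.prodMk_space (((hg.clm_apply hu).clm_apply hu).neg)
  refine (h2.of_le (by simp)).congr_of_eventuallyEq ?_
  filter_upwards [hsrc] with p hp
  refine (cov.tangentCoordChange_geodesicField hp).trans ?_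
  rw [extChartAt_tangent_apply hp]

end Geodesic

end CovariantDerivative

/-! ### Geodesics in charts and the exponential map -/

/-- A function of class `C^n` on a neighbourhood of a point agrees near this point with a global
function of class `C^n`. -/
lemma exists_contDiff_eventuallyEq_of_contDiffOn {E F : Type*} [NormedAddCommGroup E]
    [NormedSpace ℝ E] [FiniteDimensional ℝ E] [NormedAddCommGroup F] [NormedSpace ℝ F]
    {n : ℕ∞} {f : E → F} {s : Set E} {a : E} (hf : ContDiffOn ℝ n f s) (hs : s ∈ 𝓝 a) :
    ∃ g : E → F, ContDiff ℝ n g ∧ g =ᶠ[𝓝 a] f := by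
  obtain ⟨ε, hε, hs⟩ := Metric.mem_nhds_iff.1 hs
  let ψ : ContDiffBump a := ⟨ε / 4, ε / 2, by positivity, by linarith⟩
  refine ⟨fun z => ψ z • f z, contDiff_iff_contDiffAt.2 fun z => ?_, ?_⟩
  · by_cases hz : z ∈ Metric.ball a ε
    · exact ψ.contDiff.contDiffAt.smul
        (hf.contDiffAt (Filter.mem_of_superset (Metric.isOpen_ball.mem_nhds hz) hs))
    · have hz' : z ∈ (tsupport ψ)ᶜ := by
        rw [ψ.tsupport_eq, mem_compl_iff, Metric.mem_closedBall]
        rw [Metric.mem_ball] at hz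
        change ¬ dist z a ≤ ε / 2
        linarith
      refine (contDiffAt_const (c := (0 : F))).congr_of_eventuallyEq ?_
      filter_upwards [(isClosed_tsupport ψ).isOpen_compl.mem_nhds hz'] with y hy
      rw [image_eq_zero_of_notMem_tsupport hy, zero_smul]
  · filter_upwards [ψ.eventuallyEq_one] with z hz
    rw [hz, Pi.one_apply, one_smul]

namespace CovariantDerivative

variable {E : Type*} [NormedAddCommGroup E] [NormedSpace ℝ E]
  {M : Type*} [TopologicalSpace M] [ChartedSpace E M] [IsManifold 𝓘(ℝ, E) ∞ M]
  [FiniteDimensional ℝ E]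
  (cov : CovariantDerivative 𝓘(ℝ, E) E (TangentSpace 𝓘(ℝ, E) : M → Type _))

omit [FiniteDimensional ℝ E] in
-- The chart on `ℝ` is the identity, so this only unfolds the manifold derivative in the chart at `c
-- t`.
lemma hasMFDerivAt_curve_iff {c : ℝ → TangentBundle 𝓘(ℝ, E) M} {t : ℝ}
    {η : TangentSpace 𝓘(ℝ, E).tangent (c t)} :
    HasMFDerivAt 𝓘(ℝ, ℝ) 𝓘(ℝ, E).tangent c t ((1 : ℝ →L[ℝ] ℝ).smulRight η) ↔
      ContinuousAt c t ∧ HasDerivAt (extChartAt 𝓘(ℝ, E).tangent (c t) ∘ c) (η : E × E) t := by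
  refine and_congr Iff.rfl ?_
  rw [ModelWithCorners.range_eq_univ]
  have h : HasFDerivWithinAt (extChartAt 𝓘(ℝ, E).tangent (c t) ∘ c)
      ((1 : ℝ →L[ℝ] ℝ).smulRight (η : E × E)) univ t ↔
      HasDerivAt (extChartAt 𝓘(ℝ, E).tangent (c t) ∘ c) (η : E × E) t := by
    rw [hasFDerivWithinAt_univ]
    exact hasDerivAt_iff_hasFDerivAt.symm
  exact h

/-- A curve in the tangent bundle that satisfies the geodesic equation in a chart is tangent to the
geodesic field. -/
lemma hasMFDerivAt_geodesicField_of_hasDerivAt {α : ℝ → E × E} {t : ℝ}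
    {q : TangentBundle 𝓘(ℝ, E) M} (hα : (α t).1 ∈ (extChartAt 𝓘(ℝ, E) q.1).target)
    (h : HasDerivAt α ((α t).2, -cov.chartChristoffel q.1 ((extChartAt 𝓘(ℝ, E) q.1).symm (α t).1)
      (α t).2 (α t).2) t) {c : ℝ → TangentBundle 𝓘(ℝ, E) M}
    (hc : c =ᶠ[𝓝 t] (extChartAt 𝓘(ℝ, E).tangent q).symm ∘ α) :
    HasMFDerivAt 𝓘(ℝ, ℝ) 𝓘(ℝ, E).tangent c t
      ((1 : ℝ →L[ℝ] ℝ).smulRight (cov.geodesicField (c t))) := by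
  have hct : c t = (extChartAt 𝓘(ℝ, E).tangent q).symm (α t) := hc.self_of_nhds
  have hct' : c t = ⟨(extChartAt 𝓘(ℝ, E) q.1).symm (α t).1,
      ofCoord q.1 ((extChartAt 𝓘(ℝ, E) q.1).symm (α t).1) (α t).2⟩ := by
    rw [hct]; exact extChartAt_tangent_symm_apply hα _
  have hαt : α t ∈ (extChartAt 𝓘(ℝ, E).tangent q).target := by
    rw [extChartAt_tangent_target]; exact ⟨hα, mem_univ _⟩
  have hb : (extChartAt 𝓘(ℝ, E) q.1).symm (α t).1 ∈ (chartAt E q.1).source := by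
    rw [← extChartAt_source 𝓘(ℝ, E)]; exact (extChartAt 𝓘(ℝ, E) q.1).map_target hα
  have hq : (c t).1 ∈ (chartAt E q.1).source := by rw [hct']; exact hb
  have hself : c t ∈ (extChartAt 𝓘(ℝ, E).tangent (c t)).source := mem_extChartAt_source _
  have hq' : c t ∈ (extChartAt 𝓘(ℝ, E).tangent q).source := mem_extChartAt_tangent_source.2 hq
  have hfield : tangentCoordChange 𝓘(ℝ, E).tangent (c t) q (c t) (cov.geodesicField (c t)) =
      ((α t).2, -cov.chartChristoffel q.1 ((extChartAt 𝓘(ℝ, E) q.1).symm (α t).1)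
        (α t).2 (α t).2) := by
    rw [cov.tangentCoordChange_geodesicField hq]
    have e1 : (c t).1 = (extChartAt 𝓘(ℝ, E) q.1).symm (α t).1 := by rw [hct']
    have e2 : toCoord q.1 (c t).1 (c t).2 = (α t).2 := by rw [hct']; exact toCoord_ofCoord hb _
    rw [e2, e1]
  rw [← hfield] at h
  have hsymm : ContinuousAt (extChartAt 𝓘(ℝ, E).tangent q).symm (α t) :=
    continuousAt_extChartAt_symm'' hαt
  refine hasMFDerivAt_curve_iff.2
    ⟨(ContinuousAt.comp hsymm h.continuousAt).congr_of_eventuallyEq hc, ?_⟩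
  obtain ⟨G, hG⟩ : ∃ G : E × E, cov.geodesicField (c t) = G := ⟨_, rfl⟩
  rw [hG] at h ⊢
  -- The field was carried from the chart at `c t` to the chart at `q`; carrying it back gives the
  -- original value.
  have e : tangentCoordChange 𝓘(ℝ, E).tangent q (c t) (c t)
      (tangentCoordChange 𝓘(ℝ, E).tangent (c t) q (c t) G) = G := by
    rw [tangentCoordChange_comp ⟨⟨hself, hq'⟩, hself⟩]
    exact tangentCoordChange_self hself
  have h1 := hasFDerivWithinAt_tangentCoordChange (I := 𝓘(ℝ, E).tangent) (z := c t) ⟨hq', hself⟩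
  rw [ModelWithCorners.range_eq_univ, hasFDerivWithinAt_univ] at h1
  have e3 : extChartAt 𝓘(ℝ, E).tangent q (c t) = α t := by
    rw [hct]; exact (extChartAt 𝓘(ℝ, E).tangent q).right_inv hαt
  rw [e3] at h1
  have key := HasFDerivAt.comp_hasDerivAt t h1 h
  rw [e] at key
  refine key.congr_of_eventuallyEq ?_
  filter_upwards [hc] with s hs
  rw [Function.comp_apply, hs]
  rfl

omit [FiniteDimensional ℝ E] in
/-- An integral curve of the geodesic field satisfies the geodesic equation in the preferred chart
at each of its points. -/
lemma hasDerivAt_of_hasMFDerivAt_geodesicField {c : ℝ → TangentBundle 𝓘(ℝ, E) M} {t : ℝ}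
    (h : HasMFDerivAt 𝓘(ℝ, ℝ) 𝓘(ℝ, E).tangent c t
      ((1 : ℝ →L[ℝ] ℝ).smulRight (cov.geodesicField (c t)))) :
    HasDerivAt (extChartAt 𝓘(ℝ, E).tangent (c t) ∘ c)
      ((c t).2, -cov.christoffel (c t).1 (c t).2 (c t).2) t :=
  (hasMFDerivAt_curve_iff.1 h).2

/-- The transition from a chart to itself is the identity near the point, so the second derivative
drops out of the transformation law. The two sides order field and direction differently. -/
lemma chartChristoffel_self (x : M) (v w : E) :
    cov.chartChristoffel x x w v = cov.christoffel x v w := by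
  have h := cov.toCoord_christoffel (mem_chart_source E x) v w
  have e : fderiv ℝ (transition x x) =ᶠ[𝓝 (extChartAt 𝓘(ℝ, E) x x)]
      fun _ => ContinuousLinearMap.id ℝ E := by
    have e1 : transition x x =ᶠ[𝓝 (extChartAt 𝓘(ℝ, E) x x)] id := by
      filter_upwards [extChartAt_target_mem_nhds x] with a ha
      exact (extChartAt 𝓘(ℝ, E) x).right_inv ha
    refine e1.fderiv.trans ?_
    filter_upwards with a
    exact fderiv_id
  rw [e.fderiv_eq, fderiv_const_apply, toCoord_self, toCoord_self] at h
  exact ((toCoord_self x _).symm.trans (h.trans (zero_add _))).symm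

variable [T2Space M] [CovariantDerivative.ContMDiffCovariantDerivative cov ∞]

/-- Uniqueness of integral curves on the smaller of the two intervals; it makes `expMap` independent
of the chosen geodesic. -/
lemma IsGeodesicFrom.eqOn {x : M} {v : TangentSpace 𝓘(ℝ, E) x}
    {c c' : ℝ → TangentBundle 𝓘(ℝ, E) M} (h : cov.IsGeodesicFrom x v c)
    (h' : cov.IsGeodesicFrom x v c') : EqOn c c' (Icc 0 1) := by
  obtain ⟨h0, ε, hε, hc⟩ := h
  obtain ⟨h0', ε', hε', hc'⟩ := h'
  have hm : 0 < min ε ε' := lt_min hε hε'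
  have h1 : Ioo (-min ε ε') (1 + min ε ε') ⊆ Ioo (-ε) (1 + ε) :=
    Ioo_subset_Ioo (neg_le_neg (min_le_left _ _)) (by gcongr; exact min_le_left _ _)
  have h2 : Ioo (-min ε ε') (1 + min ε ε') ⊆ Ioo (-ε') (1 + ε') :=
    Ioo_subset_Ioo (neg_le_neg (min_le_right _ _)) (by gcongr; exact min_le_right _ _)
  have := isMIntegralCurveOn_Ioo_eqOn_of_contMDiff_boundaryless (t₀ := 0)
    (show (0 : ℝ) ∈ Ioo (-min ε ε') (1 + min ε ε') from ⟨by linarith, by linarith⟩)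
    cov.contMDiff_geodesicField (hc.mono h1) (hc'.mono h2) (h0.trans h0'.symm)
  exact fun t ht => this (show t ∈ Ioo _ _ from ⟨by linarith [ht.1], by linarith [ht.2]⟩)

lemma IsGeodesicFrom.expMap_eq {x : M} {v : TangentSpace 𝓘(ℝ, E) x}
    {c : ℝ → TangentBundle 𝓘(ℝ, E) M} (h : cov.IsGeodesicFrom x v c) :
    cov.expMap x v = (c 1).1 := by
  have hv : v ∈ cov.expDomain x := ⟨c, h⟩
  rw [expMap, dif_pos hv]
  rw [IsGeodesicFrom.eqOn cov hv.choose_spec h (show (1 : ℝ) ∈ Icc 0 1 from ⟨zero_le_one, le_rfl⟩)]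

omit [T2Space M] [CovariantDerivative.ContMDiffCovariantDerivative cov ∞] in
/-- Rescaling the time of a geodesic. -/
lemma hasMFDerivAt_geodesicField_rescale {c : ℝ → TangentBundle 𝓘(ℝ, E) M} {r s : ℝ}
    (h : HasMFDerivAt 𝓘(ℝ, ℝ) 𝓘(ℝ, E).tangent c (r * s)
      ((1 : ℝ →L[ℝ] ℝ).smulRight (cov.geodesicField (c (r * s))))) :
    let c' : ℝ → TangentBundle 𝓘(ℝ, E) M := fun s => ⟨(c (r * s)).1, r • (c (r * s)).2⟩
    HasMFDerivAt 𝓘(ℝ, ℝ) 𝓘(ℝ, E).tangent c' s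
      ((1 : ℝ →L[ℝ] ℝ).smulRight (cov.geodesicField (c' s))) := by
  intro c'
  obtain ⟨q, hq⟩ : ∃ q, c (r * s) = q := ⟨_, rfl⟩
  have hd₀ := cov.hasDerivAt_of_hasMFDerivAt_geodesicField h
  rw [hq] at hd₀
  obtain ⟨u, hu⟩ : ∃ u : E, q.2 = u := ⟨_, rfl⟩
  rw [hu] at hd₀
  have hd : HasDerivAt (extChartAt 𝓘(ℝ, E).tangent q ∘ c)
      (u, -cov.chartChristoffel q.1 q.1 u u) (r * s) := by
    rw [cov.chartChristoffel_self]; exact hd₀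
  have hm : HasDerivAt (fun s => r * s) r s := by simpa using (hasDerivAt_id s).const_mul r
  have hd' := hd.scomp s hm
  have hbase : extChartAt 𝓘(ℝ, E).tangent q (c (r * s)) = (extChartAt 𝓘(ℝ, E) q.1 q.1, u) := by
    rw [hq, extChartAt_tangent_apply (mem_chart_source E q.1), hu]
    exact congrArg _ (toCoord_self q.1 u)
  let α : ℝ → E × E := fun s =>
    ((extChartAt 𝓘(ℝ, E).tangent q (c (r * s))).1, r • (extChartAt 𝓘(ℝ, E).tangent q (c (r * s))).2)
  have hαs : α s = (extChartAt 𝓘(ℝ, E) q.1 q.1, r • u) := by simp only [α, hbase]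
  have hc : ∀ᶠ s' in 𝓝 s, (c (r * s')).1 ∈ (chartAt E q.1).source := by
    have hc1 : ContinuousAt (fun s' => (c (r * s')).1) s :=
      (FiberBundle.continuous_proj E (TangentSpace 𝓘(ℝ, E) : M → Type _)).continuousAt.comp
        (ContinuousAt.comp (g := c) h.continuousAt hm.continuousAt)
    refine hc1.eventually ?_
    change _ ∈ 𝓝 (c (r * s)).1
    rw [hq]
    exact chart_source_mem_nhds E q.1
  refine cov.hasMFDerivAt_geodesicField_of_hasDerivAt (α := α) (q := q) ?_ ?_ ?_
  · rw [hαs]; exact mem_extChartAt_target q.1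
  · rw [hαs, extChartAt_to_inv]
    -- Position picks up one factor `r` and velocity two, which matches `Γ(r u, r u) = r² Γ(u, u)`.
    have h1 := (ContinuousLinearMap.fst ℝ E E).hasFDerivAt.comp_hasDerivAt s hd'
    have h2 := ((ContinuousLinearMap.snd ℝ E E).hasFDerivAt.comp_hasDerivAt s hd').const_smul r
    refine (h1.prodMk h2).congr_deriv (Prod.ext rfl ?_)
    simp
  · filter_upwards [hc] with s' hs'
    have hmem : c' s' ∈ (extChartAt 𝓘(ℝ, E).tangent q).source :=
      mem_extChartAt_tangent_source.2 hs'
    refine ((extChartAt 𝓘(ℝ, E).tangent q).left_inv hmem).symm.trans (congrArg _ ?_)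
    have e := extChartAt_tangent_apply (p := q) (q := c' s') hs'
    simp only [α, extChartAt_tangent_apply hs']
    rw [e]
    exact congrArg _ (map_smul _ _ _)

/-- The points `exp (r v)` describe the geodesic with initial velocity `v`. -/
lemma expMap_smul {x : M} {v : TangentSpace 𝓘(ℝ, E) x}
    {c : ℝ → TangentBundle 𝓘(ℝ, E) M} (h0 : c 0 = ⟨x, v⟩) {ε : ℝ} (hε : 0 < ε)
    (hc : IsMIntegralCurveOn (I := 𝓘(ℝ, E).tangent) c cov.geodesicField (Ioo (-ε) ε)) {r : ℝ}
    (hr : |r| < ε / 2) : cov.expMap x (r • v) = (c r).1 := by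
  have h : cov.IsGeodesicFrom x (r • v) fun s => ⟨(c (r * s)).1, r • (c (r * s)).2⟩ := by
    have h0' : c (r * 0) = ⟨x, v⟩ := by rw [mul_zero, h0]
    refine ⟨congrArg (fun p : TangentBundle 𝓘(ℝ, E) M =>
      (⟨p.1, r • p.2⟩ : TangentBundle 𝓘(ℝ, E) M)) h0', 1, one_pos, fun s hs => ?_⟩
    refine (cov.hasMFDerivAt_geodesicField_rescale ?_).hasMFDerivWithinAt
    -- The rescaled curve is used for `s` in `(-1, 2)`, so `|s| < 2`; this is why `|r| < ε / 2` is
    -- assumed.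
    have hmem : r * s ∈ Ioo (-ε) ε := by
      rw [mem_Ioo, ← abs_lt, abs_mul]
      have : |s| < 2 := by rw [abs_lt]; constructor <;> linarith [hs.1, hs.2]
      nlinarith [abs_nonneg r, abs_nonneg s]
    exact (hc _ hmem).hasMFDerivAt (isOpen_Ioo.mem_nhds hmem)
  rw [h.expMap_eq, mul_one]

/-- Local description of the exponential map. -/
lemma exists_geodesics (x : M) : ∃ ξ : E → E, ContDiffAt ℝ ∞ ξ 0 ∧
    ξ 0 ∈ (extChartAt 𝓘(ℝ, E) x).target ∧
    ∀ᶠ v : E in 𝓝 (0 : E), ∃ c, cov.IsGeodesicFrom x v c ∧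
      (c 1).1 = (extChartAt 𝓘(ℝ, E) x).symm (ξ v) := by
  -- The chart of the tangent bundle at `q` depends only on the base point of `q`, so any vector
  -- over `x` serves.
  obtain ⟨q, hq⟩ : ∃ q : TangentBundle 𝓘(ℝ, E) M, q.1 = x := ⟨⟨x, 0⟩, rfl⟩
  have hsm : ContDiffOn ℝ ∞ (cov.chartChristoffel x ∘ (extChartAt 𝓘(ℝ, E) x).symm)
      (extChartAt 𝓘(ℝ, E) x).target := by
    rw [← contMDiffOn_iff_contDiffOn]
    refine (cov.contMDiffOn_chartChristoffel x).comp (contMDiffOn_extChartAt_symm x) fun a ha => ?_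
    rw [mem_preimage, ← extChartAt_source 𝓘(ℝ, E)]
    exact (extChartAt 𝓘(ℝ, E) x).map_target ha
  -- The equation is solved with globally smooth coefficients `g`; for small `v` the solution stays
  -- where `g` equals the Christoffel symbols.
  obtain ⟨g, hg, hge⟩ := exists_contDiff_eventuallyEq_of_contDiffOn hsm
    (extChartAt_target_mem_nhds x)
  obtain ⟨ξ, u, hξ, hξ0, hN, hode⟩ := exists_contDiffAt_quadratic_flow hg (extChartAt 𝓘(ℝ, E) x x)
  refine ⟨fun v => ξ v 1, hξ, ?_, ?_⟩
  · change ξ 0 1 ∈ _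
    rw [hξ0]; exact mem_extChartAt_target x
  filter_upwards [hode, hN _ (Filter.inter_mem hge (extChartAt_target_mem_nhds x))]
    with v ⟨hv0, hu0, hv⟩ hvN
  have h00 : (0 : ℝ) ∈ Ioo (-1 : ℝ) 2 := by norm_num
  have h11 : (1 : ℝ) ∈ Ioo (-1 : ℝ) 2 := by norm_num
  let c : ℝ → TangentBundle 𝓘(ℝ, E) M := (extChartAt 𝓘(ℝ, E).tangent q).symm ∘ fun t => (ξ v t, u v t)
  subst hq
  have hct : ∀ t ∈ Ioo (-1 : ℝ) 2, c t = ⟨(extChartAt 𝓘(ℝ, E) q.1).symm (ξ v t),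
      ofCoord q.1 ((extChartAt 𝓘(ℝ, E) q.1).symm (ξ v t)) (u v t)⟩ := fun t ht =>
    extChartAt_tangent_symm_apply (hvN t ht).2 _
  refine ⟨c, ⟨?_, 1, one_pos, fun t ht => ?_⟩, ?_⟩
  · rw [hct 0 h00, hv0, hu0, extChartAt_to_inv]
    exact congrArg _ (ofCoord_self q.1 v)
  · have ht' : t ∈ Ioo (-1 : ℝ) 2 := ⟨ht.1, by linarith [ht.2]⟩
    refine HasMFDerivAt.hasMFDerivWithinAt ?_
    refine cov.hasMFDerivAt_geodesicField_of_hasDerivAt (q := q) (α := fun t => (ξ v t, u v t))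
      (hvN t ht').2 ?_ Filter.EventuallyEq.rfl
    have e : g (ξ v t) = _ := (hvN t ht').1
    have := (hv t ht').1.prodMk (hv t ht').2
    rw [e] at this
    exact this
  · rw [hct 1 h11]

lemma expDomain_mem_nhds (x : M) : cov.expDomain x ∈ 𝓝 (0 : E) := by
  obtain ⟨ξ, -, -, h⟩ := cov.exists_geodesics x
  filter_upwards [h] with v ⟨c, hc, _⟩
  exact ⟨c, hc⟩

lemma contDiffAt_expPullback {F : Type*} [NormedAddCommGroup F] [NormedSpace ℝ F] {f : M → F}
    (hf : ContMDiff 𝓘(ℝ, E) 𝓘(ℝ, F) ∞ f) (x : M) : ContDiffAt ℝ ∞ (cov.expPullback f x) 0 := by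
  obtain ⟨ξ, hξ, h0, h⟩ := cov.exists_geodesics x
  have h1 : ContDiffAt ℝ ∞ (f ∘ (extChartAt 𝓘(ℝ, E) x).symm) (ξ 0) := by
    rw [← contMDiffAt_iff_contDiffAt]
    exact hf.contMDiffAt.comp _ ((contMDiffOn_extChartAt_symm x).contMDiffAt
      ((isOpen_extChartAt_target x).mem_nhds h0))
  refine (h1.comp 0 hξ).congr_of_eventuallyEq ?_
  filter_upwards [h] with v ⟨c, hc, hc1⟩
  rw [expPullback, hc.expMap_eq, hc1]
  rfl

end CovariantDerivative

/-! ### Smooth tensor fields and the covariant differential in a fixed chart -/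

set_option synthInstance.maxHeartbeats 200000 in
/-- In finite dimension, the smoothness of a family of multilinear maps can be checked pointwise. -/
lemma contDiffOn_continuousMultilinearMap_of_apply {D E F : Type*} [NormedAddCommGroup D]
    [NormedSpace ℝ D] [NormedAddCommGroup E] [NormedSpace ℝ E] [FiniteDimensional ℝ E]
    [NormedAddCommGroup F] [NormedSpace ℝ F] {n : ℕ∞ω} {s : Set D} {r : ℕ} {f : D → E [×r]→L[ℝ] F}
    (hf : ∀ m, ContDiffOn ℝ n (fun a => f a m) s) : ContDiffOn ℝ n f s := by
  induction r with
  | zero =>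
    have h := (continuousMultilinearCurryFin0 ℝ E F).symm.contDiff.comp_contDiffOn
      (hf 0)
    refine h.congr fun a _ => ?_
    ext m
    simp [Subsingleton.elim m 0]
  | succ r ih =>
    have h : ContDiffOn ℝ n (fun a => (f a).curryLeft) s :=
      contDiffOn_clm_apply.2 fun v => ih fun m => hf (Fin.cons v m)
    refine ((continuousMultilinearCurryLeftEquiv ℝ (fun _ : Fin (r + 1) => E)
      F).symm.contDiff.comp_contDiffOn h).congr fun a _ => ?_
    exact ((f a).uncurry_curryLeft).symm

lemma contDiff_continuousMultilinearMap_uncurry {E F : Type*} [NormedAddCommGroup E]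
    [NormedSpace ℝ E] [NormedAddCommGroup F] [NormedSpace ℝ F] {n : ℕ∞ω} {r : ℕ} :
    ContDiff ℝ n (fun p : (E [×r]→L[ℝ] F) × (Fin r → E) => p.1 p.2) := by
  rw [← contDiffOn_univ]
  exact AnalyticOnNhd.contDiffOn (fun p _ =>
    (ContinuousLinearMap.id ℝ (E [×r]→L[ℝ] F)).analyticAt_uncurry_of_multilinear)
    uniqueDiffOn_univ

namespace CovariantDerivative

variable {E : Type*} [NormedAddCommGroup E] [NormedSpace ℝ E]
  {M : Type*} [TopologicalSpace M] [ChartedSpace E M] [IsManifold 𝓘(ℝ, E) ∞ M]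
  {F : Type*} [NormedAddCommGroup F] [NormedSpace ℝ F] {r : ℕ}

/-- The components of a covariant tensor field, as functions of the coordinates of the preferred
chart at `x`. -/
def tensorCoord (T : ∀ x : M, CovTensor E F r x) (x : M) (a : E) : E [×r]→L[ℝ] F :=
  tensorInChart T x ((extChartAt 𝓘(ℝ, E) x).symm a)

/-- A covariant tensor field is smooth if its components in the preferred charts are smooth. -/
def IsSmoothTensor (T : ∀ x : M, CovTensor E F r x) : Prop :=
  ∀ x, ContDiffOn ℝ ∞ (tensorCoord T x) (extChartAt 𝓘(ℝ, E) x).target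

lemma tensorCoord_extChartAt (T : ∀ x : M, CovTensor E F r x) {x y : M}
    (hy : y ∈ (chartAt E x).source) :
    tensorCoord T x (extChartAt 𝓘(ℝ, E) x y) = tensorInChart T x y := by
  rw [tensorCoord, (extChartAt 𝓘(ℝ, E) x).left_inv (by rwa [extChartAt_source])]

lemma tensorInChart_self (T : ∀ x : M, CovTensor E F r x) (x : M) (w : Fin r → E) :
    tensorInChart T x x w = T x w :=
  congrArg (T x) (funext fun i => ofCoord_self x (w i))

lemma tensorInChart_toCoord (T : ∀ x : M, CovTensor E F r x) {x y : M}
    (hy : y ∈ (chartAt E x).source) (w : Fin r → E) :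
    tensorInChart T x y (fun i => toCoord x y (w i)) = T y w :=
  congrArg (T y) (funext fun i => ofCoord_toCoord hy (w i))

/-- The change of the components of a tensor field between two preferred charts. -/
lemma tensorCoord_eventuallyEq (T : ∀ x : M, CovTensor E F r x) {x y : M}
    (hy : y ∈ (chartAt E x).source) (w : Fin r → E) :
    (fun a => tensorCoord T y a w) =ᶠ[𝓝 (extChartAt 𝓘(ℝ, E) y y)]
      fun a => tensorCoord T x (transition x y a) (fun i => fderiv ℝ (transition x y) a (w i)) := by
  have h1 : ∀ᶠ a in 𝓝 (extChartAt 𝓘(ℝ, E) y y),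
      (extChartAt 𝓘(ℝ, E) y).symm a ∈ (chartAt E x).source := by
    refine (continuousAt_extChartAt_symm y).eventually ?_
    rw [extChartAt_to_inv]
    exact (chartAt E x).open_source.mem_nhds hy
  filter_upwards [h1, extChartAt_target_mem_nhds (I := 𝓘(ℝ, E)) y] with a ha ha'
  obtain ⟨z, hz, rfl⟩ : ∃ z ∈ (chartAt E y).source, extChartAt 𝓘(ℝ, E) y z = a :=
    ⟨(extChartAt 𝓘(ℝ, E) y).symm a, by
      rw [← extChartAt_source 𝓘(ℝ, E)]; exact (extChartAt 𝓘(ℝ, E) y).map_target ha',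
      (extChartAt 𝓘(ℝ, E) y).right_inv ha'⟩
  rw [(extChartAt 𝓘(ℝ, E) y).left_inv (by rwa [extChartAt_source])] at ha
  rw [tensorCoord_extChartAt T hz, transition_apply hz, tensorCoord_extChartAt T ha,
    ← tangentCoordChange_eq_fderiv]
  exact congrArg (T z) (funext fun i => (ofCoord_tangentCoordChange ha hz (w i)).symm)

variable [FiniteDimensional ℝ E]
  (cov : CovariantDerivative 𝓘(ℝ, E) E (TangentSpace 𝓘(ℝ, E) : M → Type _))
  {T : ∀ x : M, CovTensor E F r x}

omit [FiniteDimensional ℝ E] in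
lemma IsSmoothTensor.contDiffAt (hT : IsSmoothTensor T) {x y : M}
    (hy : y ∈ (chartAt E x).source) :
    ContDiffAt ℝ ∞ (tensorCoord T x) (extChartAt 𝓘(ℝ, E) x y) := by
  rw [← extChartAt_source 𝓘(ℝ, E)] at hy
  exact (hT x).contDiffAt ((isOpen_extChartAt_target x).mem_nhds
    ((extChartAt 𝓘(ℝ, E) x).map_source hy))

omit [FiniteDimensional ℝ E] in
lemma derivTerm_apply (hT : IsSmoothTensor T) (y : M) (v : E) (w : Fin r → E) :
    derivTerm T y (Fin.cons v w : Fin (r + 1) → E) =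
      fderiv ℝ (tensorCoord T y) (extChartAt 𝓘(ℝ, E) y y) v w := by
  have h := (hT.contDiffAt (mem_chart_source E y)).differentiableAt (by simp)
  have h1 := (hasMFDerivAt_comp_extChartAt_self h.hasFDerivAt).congr_of_eventuallyEq
    (f₁ := tensorInChart T y) (by
      filter_upwards [chart_source_mem_nhds E y] with z hz
      exact (tensorCoord_extChartAt T hz).symm)
  exact congrArg (fun A : E →L[ℝ] E [×r]→L[ℝ] F => A v w) h1.mfderiv

/-- The covariant differential in the preferred chart at the point. -/
lemma covDifferential_cons (hT : IsSmoothTensor T) (y : M) (v : E) (w : Fin r → E) :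
    cov.covDifferential T y (Fin.cons v w : Fin (r + 1) → E) =
      fderiv ℝ (tensorCoord T y) (extChartAt 𝓘(ℝ, E) y y) v w -
      ∑ i, T y (Function.update w i (cov.christoffel y v (w i)) : Fin r → E) := by
  have key : ∀ (A : E [×(r + 1)]→L[ℝ] F) (B : Fin r → E [×(r + 1)]→L[ℝ] F) (m : Fin (r + 1) → E),
      (A - ∑ i, B i) m = A m - ∑ i, B i m := fun A B m => by
    rw [_root_.sub_apply, _root_.sum_apply]
  exact (key _ _ _).trans (congrArg₂ _ (derivTerm_apply hT y v w) rfl)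

/-- The components of the covariant differential in a preferred chart. -/
lemma tensorInChart_covDifferential (hT : IsSmoothTensor T) {x y : M}
    (hy : y ∈ (chartAt E x).source) (v : E) (w : Fin r → E) :
    tensorInChart (cov.covDifferential T) x y (Fin.cons v w : Fin (r + 1) → E) =
      fderiv ℝ (tensorCoord T x) (extChartAt 𝓘(ℝ, E) x y) v w -
      ∑ i, tensorCoord T x (extChartAt 𝓘(ℝ, E) x y)
        (Function.update w i (cov.chartChristoffel x y (w i) v)) := by
  obtain ⟨v', hv'⟩ : ∃ v' : E, toCoord x y v' = v := ⟨ofCoord x y v, toCoord_ofCoord hy v⟩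
  obtain ⟨w', hw'⟩ : ∃ w' : Fin r → E, ∀ i, toCoord x y (w' i) = w i :=
    ⟨fun i => ofCoord x y (w i), fun i => toCoord_ofCoord hy (w i)⟩
  have hcons : (Fin.cons v w : Fin (r + 1) → E) =
      fun i => toCoord x y ((Fin.cons v' w' : Fin (r + 1) → E) i) := by
    funext i
    induction i using Fin.cases with
    | zero => exact hv'.symm
    | succ i => exact (hw' i).symm
  rw [hcons, tensorInChart_toCoord _ hy, cov.covDifferential_cons hT]
  set A : E →L[ℝ] E := fderiv ℝ (transition x y) (extChartAt 𝓘(ℝ, E) y y) with hA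
  have hAc : ∀ u : E, A u = toCoord x y u := fun u => by
    rw [hA, ← tangentCoordChange_eq_fderiv, tangentCoordChange_eq_toCoord hy]
  have hψ := (contDiffAt_transition hy (mem_chart_source E y)).differentiableAt (by simp)
  have hτ := (hT.contDiffAt hy).differentiableAt (by simp)
  rw [← transition_apply (mem_chart_source E y)] at hτ
  -- The components at `y` are those at `x` evaluated on Jacobian images of the arguments. The
  -- product rule gives the derivative of the components plus one second-derivative term per
  -- argument.
  have h1 := HasFDerivAt.continuousMultilinearMap_apply
    (hτ.hasFDerivAt.comp _ hψ.hasFDerivAt)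
    (fun i => hasFDerivAt_fderiv_transition_apply hy (w' i))
  have h2 : HasFDerivAt (fun a => tensorCoord T y a w') _ _ :=
    h1.congr_of_eventuallyEq (tensorCoord_eventuallyEq T hy w')
  have h3 := ((hT.contDiffAt (mem_chart_source E y)).differentiableAt
    (by simp)).hasFDerivAt.continuousMultilinear_apply_const w'
  have h4 := congrArg (fun A => A v') (h3.unique h2)
  have hw : (fun i => A (w' i)) = w := funext fun i => (hAc _).trans (hw' i)
  have hv : A v' = v := (hAc _).trans hv'
  have e1 : ∀ (i : Fin r) (g : E), toCoord x y g =
      fderiv ℝ (fderiv ℝ (transition x y)) (extChartAt 𝓘(ℝ, E) y y) v' (w' i) +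
        cov.chartChristoffel x y (w i) v → T y (Function.update w' i g : Fin r → E) =
      tensorCoord T x (extChartAt 𝓘(ℝ, E) x y) (Function.update w i
        (fderiv ℝ (fderiv ℝ (transition x y)) (extChartAt 𝓘(ℝ, E) y y) v' (w' i))) +
      tensorCoord T x (extChartAt 𝓘(ℝ, E) x y)
        (Function.update w i (cov.chartChristoffel x y (w i) v)) := by
    intro i g hg
    rw [← ContinuousMultilinearMap.map_update_add, tensorCoord_extChartAt T hy,
      ← tensorInChart_toCoord T hy]
    congr 1
    funext j
    rcases eq_or_ne j i with rfl | hj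
    · rw [Function.update_self, Function.update_self, hg]
    · rw [Function.update_of_ne hj, Function.update_of_ne hj]
      exact hw' j
  have e2 := Finset.sum_congr (s₁ := Finset.univ) rfl fun i (_ : i ∈ Finset.univ) =>
    e1 i (cov.christoffel y v' (w' i)) (by
      rw [← hv', ← hw' i]; exact cov.toCoord_christoffel hy v' (w' i))
  rw [Finset.sum_add_distrib] at e2
  refine (congrArg _ e2).trans ?_
  -- These second-derivative terms are exactly the ones produced by the Christoffel symbols in `e2`,
  -- and cancel.
  have e3 : fderiv ℝ (tensorCoord T y) (extChartAt 𝓘(ℝ, E) y y) v' w' =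
      fderiv ℝ (tensorCoord T x) (extChartAt 𝓘(ℝ, E) x y) v w +
      ∑ i, tensorCoord T x (extChartAt 𝓘(ℝ, E) x y) (Function.update w i
        (fderiv ℝ (fderiv ℝ (transition x y)) (extChartAt 𝓘(ℝ, E) y y) v' (w' i))) := by
    refine h4.trans ?_
    rw [_root_.add_apply, _root_.sum_apply]
    simp only [ContinuousLinearMap.comp_apply, Function.comp_apply,
      transition_apply (mem_chart_source E y), ContinuousMultilinearMap.apply_apply,
      ContinuousMultilinearMap.toContinuousLinearMap_apply, ContinuousLinearMap.flip_apply,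
      ← hA, hw, hv]
  rw [e3]
  abel

variable [T2Space M] [CovariantDerivative.ContMDiffCovariantDerivative cov ∞]

/-- Over the whole domain of one chart, `∇T` is given by the derivative of the components of `T` and
the smooth Christoffel symbols of that chart. -/
lemma IsSmoothTensor.covDifferential (hT : IsSmoothTensor T) :
    IsSmoothTensor (cov.covDifferential T) := by
  intro x
  refine contDiffOn_continuousMultilinearMap_of_apply fun m => ?_
  have hΓ : ContDiffOn ℝ ∞ (cov.chartChristoffel x ∘ (extChartAt 𝓘(ℝ, E) x).symm)
      (extChartAt 𝓘(ℝ, E) x).target := by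
    rw [← contMDiffOn_iff_contDiffOn]
    refine (cov.contMDiffOn_chartChristoffel x).comp (contMDiffOn_extChartAt_symm x) fun a ha => ?_
    rw [mem_preimage, ← extChartAt_source 𝓘(ℝ, E)]
    exact (extChartAt 𝓘(ℝ, E) x).map_target ha
  have hd : ContDiffOn ℝ ∞ (fderiv ℝ (tensorCoord T x)) (extChartAt 𝓘(ℝ, E) x).target :=
    (hT x).fderiv_of_isOpen (isOpen_extChartAt_target x) (by simp)
  have h1 : ContDiffOn ℝ ∞ (fun a => fderiv ℝ (tensorCoord T x) a (m 0) (Fin.tail m))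
      (extChartAt 𝓘(ℝ, E) x).target :=
    contDiff_continuousMultilinearMap_uncurry.comp_contDiffOn
      ((hd.clm_apply contDiffOn_const).prodMk contDiffOn_const)
  have h2 : ∀ i : Fin r, ContDiffOn ℝ ∞ (fun a => tensorCoord T x a (Function.update (Fin.tail m) i
      (cov.chartChristoffel x ((extChartAt 𝓘(ℝ, E) x).symm a) (Fin.tail m i) (m 0))))
      (extChartAt 𝓘(ℝ, E) x).target := fun i => by
    refine contDiff_continuousMultilinearMap_uncurry.comp_contDiffOn ((hT x).prodMk ?_)
    refine contDiffOn_pi.2 fun j => ?_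
    rcases eq_or_ne j i with rfl | hj
    · exact ((hΓ.clm_apply (contDiffOn_const (c := Fin.tail m j))).clm_apply
        (contDiffOn_const (c := m 0))).congr fun a _ => Function.update_self _ _ _
    · exact (contDiffOn_const (c := Fin.tail m j)).congr fun a _ => Function.update_of_ne hj _ _
  refine (h1.sub (ContDiffOn.sum fun i (_ : i ∈ Finset.univ) => h2 i)).congr fun a ha => ?_
  have hy : (extChartAt 𝓘(ℝ, E) x).symm a ∈ (chartAt E x).source := by
    rw [← extChartAt_source 𝓘(ℝ, E)]; exact (extChartAt 𝓘(ℝ, E) x).map_target ha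
  have h := cov.tensorInChart_covDifferential hT hy (m 0) (Fin.tail m)
  rw [(extChartAt 𝓘(ℝ, E) x).right_inv ha, Fin.cons_self_tail] at h
  exact h

lemma isSmoothTensor_iteratedCovDifferential {f : M → F} (hf : ContMDiff 𝓘(ℝ, E) 𝓘(ℝ, F) ∞ f)
    (r : ℕ) : IsSmoothTensor (cov.iteratedCovDifferential f r) := by
  induction r with
  | zero =>
    intro x
    refine contDiffOn_continuousMultilinearMap_of_apply fun m => ?_
    have h : ContDiffOn ℝ ∞ (f ∘ (extChartAt 𝓘(ℝ, E) x).symm) (extChartAt 𝓘(ℝ, E) x).target := by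
      rw [← contMDiffOn_iff_contDiffOn]
      exact hf.comp_contMDiffOn (contMDiffOn_extChartAt_symm x)
    exact h
  | succ r ih => exact ih.covDifferential cov

end CovariantDerivative

/-! ### Symmetry of higher differentials and polarization -/

/-- Iterated derivatives of a function along a line. -/
lemma iteratedDeriv_comp_smul {E F : Type*} [NormedAddCommGroup E] [NormedSpace ℝ E]
    [NormedAddCommGroup F] [NormedSpace ℝ F] {g : E → F} {r : ℕ}
    (hg : ContDiff ℝ r g) (v : E) :
    iteratedDeriv r (fun t : ℝ => g (t • v)) 0 = iteratedFDeriv ℝ r g 0 fun _ => v := by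
  have h := congrArg (fun A => A fun _ => (1 : ℝ))
    (((1 : ℝ →L[ℝ] ℝ).smulRight v).iteratedFDeriv_comp_right hg 0 (i := r)
      le_rfl)
  rw [iteratedDeriv_eq_iteratedFDeriv]
  refine Eq.trans ?_ (h.trans ?_)
  · rfl
  · simp

/-- Iterated derivatives are invariant under the exchange of two consecutive arguments. -/
lemma iteratedFDeriv_comp_swap {E F : Type*} [NormedAddCommGroup E] [NormedSpace ℝ E]
    [NormedAddCommGroup F] [NormedSpace ℝ F] {g : E → F} {n : ℕ}
    (hg : ContDiff ℝ (n + 1 : ℕ) g) (i : Fin n) (a : E) (v : Fin (n + 1) → E) :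
    iteratedFDeriv ℝ (n + 1) g a (v ∘ Equiv.swap i.castSucc i.succ) =
      iteratedFDeriv ℝ (n + 1) g a v := by
  induction n generalizing a with
  | zero => exact i.elim0
  | succ n ih =>
    have key : ∀ (m : Fin (n + 1) → E) (w : E), fderiv ℝ (iteratedFDeriv ℝ (n + 1) g) a w m =
        fderiv ℝ (fun x => iteratedFDeriv ℝ (n + 1) g x m) a w := fun m w =>
      (fderiv_continuousMultilinear_apply_const_apply
        (hg.differentiable_iteratedFDeriv (by exact_mod_cast Nat.lt_succ_self _) a) m w).symm
    rw [iteratedFDeriv_succ_apply_left, iteratedFDeriv_succ_apply_left, key, key]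
    -- Swapping the first two arguments is the symmetry of the second derivative of the `n`-th
    -- differential; any later swap acts on the function being differentiated, where the induction
    -- hypothesis holds at every point.
    induction i using Fin.cases with
    | zero =>
      have hd : ContDiff ℝ 2 (iteratedFDeriv ℝ n g) :=
        hg.iteratedFDeriv_right (by norm_cast; omega)
      have h2 : ∀ (m : Fin (n + 1) → E) (w : E),
          fderiv ℝ (fun x => iteratedFDeriv ℝ (n + 1) g x m) a w =
            fderiv ℝ (fderiv ℝ (iteratedFDeriv ℝ n g)) a w (m 0) (Fin.tail m) := fun m w => by
        have hdd : Differentiable ℝ (fderiv ℝ (iteratedFDeriv ℝ n g)) :=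
          (hd.fderiv_right (m := 1) (by norm_num)).differentiable (by simp)
        have h3 := ((hdd a).hasFDerivAt.clm_apply (hasFDerivAt_const (m 0) a))
          |>.continuousMultilinear_apply_const (Fin.tail m)
        refine (congrArg (fun A => A w) h3.fderiv).trans ?_
        simp
      have hs : IsSymmSndFDerivAt ℝ (iteratedFDeriv ℝ n g) a :=
        hd.contDiffAt.isSymmSndFDerivAt
          (by rw [minSmoothness_of_isRCLikeNormedField])
      rw [h2, h2, hs.eq]
      have e0 : (v ∘ Equiv.swap (Fin.castSucc 0) (Fin.succ 0)) 0 = Fin.tail v 0 := by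
        simp [Fin.tail]
      have e1 : Fin.tail (v ∘ Equiv.swap (Fin.castSucc 0) (Fin.succ 0)) 0 = v 0 := by
        simp [Fin.tail]
      have e2 : Fin.tail (Fin.tail (v ∘ Equiv.swap (Fin.castSucc 0) (Fin.succ 0))) =
          Fin.tail (Fin.tail v) := by
        funext j
        refine congrArg v (Equiv.swap_apply_of_ne_of_ne ?_ ?_)
        · exact Fin.succ_ne_zero _
        · exact fun h => Fin.succ_ne_zero j (Fin.succ_injective _ h)
      rw [e0, e1, e2]
    | succ i =>
      have e0 : (v ∘ Equiv.swap i.succ.castSucc i.succ.succ) 0 = v 0 :=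
        congrArg v (Equiv.swap_apply_of_ne_of_ne (Fin.succ_ne_zero i.castSucc).symm
          (Fin.succ_ne_zero _).symm)
      have e1 : Fin.tail (v ∘ Equiv.swap i.succ.castSucc i.succ.succ) =
          Fin.tail v ∘ Equiv.swap i.castSucc i.succ := by
        funext j
        refine congrArg v ?_
        exact ((Fin.succ_injective _).map_swap i.castSucc i.succ j).symm
      rw [e0, e1]
      simp only [ih (hg.of_le (by norm_cast; omega)) i]

/-- The iterated derivatives of a smooth function are symmetric. -/
lemma iteratedFDeriv_comp_perm_of_contDiff {E F : Type*} [NormedAddCommGroup E] [NormedSpace ℝ E]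
    [NormedAddCommGroup F] [NormedSpace ℝ F] {g : E → F} {n : ℕ}
    (hg : ContDiff ℝ n g) (a : E)
    (v : Fin n → E) (σ : Equiv.Perm (Fin n)) :
    iteratedFDeriv ℝ n g a (v ∘ σ) = iteratedFDeriv ℝ n g a v := by
  cases n with
  | zero => exact congrArg _ (Subsingleton.elim _ _)
  | succ n =>
    have hσ : σ ∈ Submonoid.closure (Set.range fun i : Fin n => Equiv.swap i.castSucc i.succ) := by
      rw [Equiv.Perm.mclosure_swap_castSucc_succ]; trivial
    induction hσ using Submonoid.closure_induction generalizing v with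
    | mem σ h =>
      obtain ⟨i, rfl⟩ := h
      exact iteratedFDeriv_comp_swap hg i a v
    | one => rfl
    | mul σ τ _ _ h1 h2 => exact (h2 (v ∘ σ)).trans (h1 v)

/-- Polarization: the `r`-th differential of a function is determined by its diagonal values. -/
lemma iteratedFDeriv_eq_of_diagonal {E F : Type*} [NormedAddCommGroup E] [NormedSpace ℝ E]
    [NormedAddCommGroup F] [NormedSpace ℝ F] {g : E → F} {r : ℕ}
    (hg : ContDiff ℝ r g) (T : E [×r]→L[ℝ] F) {a : E} (h : ∀ v : E, iteratedFDeriv ℝ r g a (fun _ => v) = T fun _ => v) :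
    iteratedFDeriv ℝ r g a = (r ! : ℝ)⁻¹ • ∑ σ : Equiv.Perm (Fin r), T.domDomCongr σ := by
  ext v
  -- The `r`-th differential of `v ↦ A(v, …, v)` is the sum of `A` over all permutations of its
  -- arguments. For the symmetric differential of `g` this sum is `r!` times the form.
  have h1 := (iteratedFDeriv ℝ r g a).iteratedFDeriv_comp_diagonal 0 v
  have h2 := T.iteratedFDeriv_comp_diagonal 0 v
  rw [funext h, h2] at h1
  have h3 : ∀ σ : Equiv.Perm (Fin r),
      iteratedFDeriv ℝ r g a (fun i => v (σ i)) = iteratedFDeriv ℝ r g a v := fun σ =>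
    iteratedFDeriv_comp_perm_of_contDiff hg a v σ
  simp only [h3, Finset.sum_const, Finset.card_univ, Fintype.card_perm, Fintype.card_fin] at h1
  rw [_root_.smul_apply, _root_.sum_apply]
  simp only [ContinuousMultilinearMap.domDomCongr_apply]
  rw [h1, ← Nat.cast_smul_eq_nsmul ℝ, smul_smul, inv_mul_cancel₀ (by positivity), one_smul]

/-! ### Differentiation along geodesics and the main theorem -/

namespace CovariantDerivative

variable {E : Type*} [NormedAddCommGroup E] [NormedSpace ℝ E]
  {M : Type*} [TopologicalSpace M] [ChartedSpace E M] [IsManifold 𝓘(ℝ, E) ∞ M]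
  {F : Type*} [NormedAddCommGroup F] [NormedSpace ℝ F] {r : ℕ} [FiniteDimensional ℝ E]
  (cov : CovariantDerivative 𝓘(ℝ, E) E (TangentSpace 𝓘(ℝ, E) : M → Type _))

/-- Along a geodesic, the derivative of `T(ċ, …, ċ)` is `∇T(ċ, …, ċ)`. -/
lemma hasDerivAt_tensor_geodesic {T : ∀ x : M, CovTensor E F r x} (hT : IsSmoothTensor T)
    {c : ℝ → TangentBundle 𝓘(ℝ, E) M} {t : ℝ}
    (hc : HasMFDerivAt 𝓘(ℝ, ℝ) 𝓘(ℝ, E).tangent c t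
      ((1 : ℝ →L[ℝ] ℝ).smulRight (cov.geodesicField (c t)))) :
    HasDerivAt (fun s => T (c s).1 fun _ => (c s).2)
      (cov.covDifferential T (c t).1 fun _ => (c t).2) t := by
  obtain ⟨q, hq⟩ : ∃ q, c t = q := ⟨_, rfl⟩
  have hd₀ := cov.hasDerivAt_of_hasMFDerivAt_geodesicField hc
  obtain ⟨u, hu⟩ : ∃ u : E, q.2 = u := ⟨_, rfl⟩
  obtain ⟨Γ, hΓ⟩ : ∃ Γ : E, cov.christoffel q.1 q.2 q.2 = Γ := ⟨_, rfl⟩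
  have hd : HasDerivAt (extChartAt 𝓘(ℝ, E).tangent q ∘ c) (u, -Γ) t := by
    rw [← hu, ← hΓ]; rw [hq] at hd₀; exact hd₀
  have hbase : extChartAt 𝓘(ℝ, E).tangent q (c t) = (extChartAt 𝓘(ℝ, E) q.1 q.1, u) := by
    rw [hq, extChartAt_tangent_apply (mem_chart_source E q.1), hu]
    exact congrArg _ (toCoord_self q.1 u)
  have h1 := (ContinuousLinearMap.fst ℝ E E).hasFDerivAt.comp_hasDerivAt t hd
  have h2 := (ContinuousLinearMap.snd ℝ E E).hasFDerivAt.comp_hasDerivAt t hd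
  have hτ := ((hT.contDiffAt (mem_chart_source E q.1)).differentiableAt (by simp)).hasFDerivAt
  have e1 : (extChartAt 𝓘(ℝ, E).tangent q (c t)).1 = extChartAt 𝓘(ℝ, E) q.1 q.1 := by rw [hbase]
  rw [← e1] at hτ
  have h3 := HasFDerivAt.continuousMultilinearMap_apply
    (hτ.comp t h1.hasFDerivAt) (fun _ : Fin r => h2.hasFDerivAt)
  have hev : (fun s => T (c s).1 fun _ => (c s).2) =ᶠ[𝓝 t] fun s =>
      tensorCoord T q.1 (extChartAt 𝓘(ℝ, E).tangent q (c s)).1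
        fun _ => (extChartAt 𝓘(ℝ, E).tangent q (c s)).2 := by
    have hc1 : ContinuousAt (fun s => (c s).1) t :=
      (FiberBundle.continuous_proj E (TangentSpace 𝓘(ℝ, E) : M → Type _)).continuousAt.comp
        hc.continuousAt
    have : ∀ᶠ s in 𝓝 t, (c s).1 ∈ (chartAt E q.1).source := by
      refine hc1.eventually ?_
      change _ ∈ 𝓝 (c t).1
      rw [hq]
      exact chart_source_mem_nhds E q.1
    filter_upwards [this] with s hs
    rw [extChartAt_tangent_apply hs, tensorCoord_extChartAt T hs]
    exact (tensorInChart_toCoord T hs fun _ => (c s).2).symm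
  -- By the geodesic equation the velocity components have derivative `-Γ`, so each slot contributes
  -- the correction term of `∇T` for that slot.
  have h4 : HasDerivAt (fun s => tensorCoord T q.1 (extChartAt 𝓘(ℝ, E).tangent q (c s)).1
      fun _ => (extChartAt 𝓘(ℝ, E).tangent q (c s)).2)
      (fderiv ℝ (tensorCoord T q.1) (extChartAt 𝓘(ℝ, E) q.1 q.1) u (fun _ => u) +
        ∑ i, tensorCoord T q.1 (extChartAt 𝓘(ℝ, E) q.1 q.1)
          (Function.update (fun _ => u) i (-Γ))) t := by
    refine (HasFDerivAt.hasDerivAt h3).congr_deriv ?_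
    rw [_root_.add_apply, _root_.sum_apply]
    simp only [ContinuousLinearMap.comp_apply, Function.comp_apply, hbase,
      ContinuousMultilinearMap.apply_apply, ContinuousMultilinearMap.toContinuousLinearMap_apply,
      ContinuousLinearMap.toSpanSingleton_apply, one_smul, ContinuousLinearMap.coe_fst',
      ContinuousLinearMap.coe_snd']
  refine (h4.congr_of_eventuallyEq hev).congr_deriv ?_
  have e2 := cov.covDifferential_cons hT q.1 u fun _ => u
  have e3 : (Fin.cons u fun _ => u : Fin (r + 1) → E) = fun _ => u := by
    funext i
    induction i using Fin.cases <;> rfl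
  have e4 : cov.christoffel q.1 u u = Γ := by rw [← hΓ, ← hu]
  have e5 : ∀ i : Fin r, tensorCoord T q.1 (extChartAt 𝓘(ℝ, E) q.1 q.1)
      (Function.update (fun _ => u) i (-Γ)) = -T q.1 (Function.update (fun _ => u) i Γ : Fin r → E) :=
    fun i => by
      rw [tensorCoord_extChartAt T (mem_chart_source E q.1), ← tensorInChart_self]
      exact (tensorInChart T q.1 q.1).toMultilinearMap.map_update_neg _ _ _
  rw [e3] at e2
  have e6 : cov.covDifferential T (c t).1 (fun _ => (c t).2) =
      cov.covDifferential T q.1 (fun _ => u : Fin (r + 1) → E) := by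
    rw [hq, ← hu]
  refine Eq.trans ?_ (e2.symm.trans e6.symm)
  simp only [e5, Finset.sum_neg_distrib, ← sub_eq_add_neg]
  refine congrArg _ (Finset.sum_congr rfl fun i _ => ?_)
  exact congrArg (fun g : E => T q.1 (Function.update (fun _ => u) i g : Fin r → E)) e4.symm

variable [T2Space M] [CovariantDerivative.ContMDiffCovariantDerivative cov ∞]

/-- The higher derivatives of a function along a geodesic. -/
lemma iteratedDeriv_comp_geodesic {f : M → F} (hf : ContMDiff 𝓘(ℝ, E) 𝓘(ℝ, F) ∞ f)
    {c : ℝ → TangentBundle 𝓘(ℝ, E) M} {s : Set ℝ} (hs : IsOpen s)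
    (hc : IsMIntegralCurveOn (I := 𝓘(ℝ, E).tangent) c cov.geodesicField s) (r : ℕ) {t : ℝ}
    (ht : t ∈ s) : iteratedDeriv r (fun t => f (c t).1) t =
      cov.iteratedCovDifferential f r (c t).1 fun _ => (c t).2 := by
  induction r generalizing t with
  | zero => rfl
  | succ r ih =>
    have h : iteratedDeriv r (fun t => f (c t).1) =ᶠ[𝓝 t] fun t =>
        cov.iteratedCovDifferential f r (c t).1 fun _ => (c t).2 := by
      filter_upwards [hs.mem_nhds ht] with t' ht' using ih ht'
    rw [iteratedDeriv_succ, h.deriv_eq]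
    exact (cov.hasDerivAt_tensor_geodesic (cov.isSmoothTensor_iteratedCovDifferential hf r)
      ((hc t ht).hasMFDerivAt (hs.mem_nhds ht))).deriv

/-- The diagonal values of the differentials of `f ∘ exp`, for small vectors. -/
lemma iteratedFDeriv_expPullback_diagonal_of_mem {f : M → F}
    (hf : ContMDiff 𝓘(ℝ, E) 𝓘(ℝ, F) ∞ f) (x : M) {g : E → F} {r : ℕ} (hg : ContDiff ℝ r g)
    (hge : g =ᶠ[𝓝 0] cov.expPullback f x) {v : E} (hv : v ∈ cov.expDomain x) :
    iteratedFDeriv ℝ r g 0 (fun _ => v) =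
      cov.iteratedCovDifferential f r x (fun _ => v : Fin r → E) := by
  obtain ⟨c, h0, ε, hε, hc⟩ := hv
  have hsub : Ioo (-ε) ε ⊆ Ioo (-ε) (1 + ε) := Ioo_subset_Ioo_right (by linarith)
  have hc' := hc.mono hsub
  have e : (fun t : ℝ => g (t • v)) =ᶠ[𝓝 0] fun t => f (c t).1 := by
    have h1 : Filter.Tendsto (fun t : ℝ => t • v) (𝓝 0) (𝓝 (0 : E)) := by
      have : Continuous fun t : ℝ => t • v := by fun_prop
      simpa using this.tendsto 0
    filter_upwards [h1.eventually hge, Metric.ball_mem_nhds (0 : ℝ) (half_pos hε)] with t ht ht'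
    rw [mem_ball_zero_iff, Real.norm_eq_abs] at ht'
    exact ht.trans (congrArg f (cov.expMap_smul h0 hε hc' ht'))
  rw [← iteratedDeriv_comp_smul hg v, e.iteratedDeriv_eq r,
    cov.iteratedDeriv_comp_geodesic hf isOpen_Ioo hc' r (show (0 : ℝ) ∈ Ioo (-ε) ε by simp [hε])]
  exact congrArg (fun p : TangentBundle 𝓘(ℝ, E) M =>
    cov.iteratedCovDifferential f r p.1 fun _ => p.2) h0

/-- Both sides are homogeneous of degree `r` in `v`: some `s > 0` brings `s • v` into the domain of
`exp`, and `s ^ r` is then cancelled. -/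
lemma iteratedFDeriv_expPullback_diagonal {f : M → F}
    (hf : ContMDiff 𝓘(ℝ, E) 𝓘(ℝ, F) ∞ f) (x : M) {g : E → F} {r : ℕ} (hg : ContDiff ℝ r g)
    (hge : g =ᶠ[𝓝 0] cov.expPullback f x) (v : E) :
    iteratedFDeriv ℝ r g 0 (fun _ => v) =
      cov.iteratedCovDifferential f r x (fun _ => v : Fin r → E) := by
  obtain ⟨T, hT⟩ : ∃ T : E [×r]→L[ℝ] F, cov.iteratedCovDifferential f r x = T := ⟨_, rfl⟩
  have h : ∀ᶠ s : ℝ in 𝓝 0, s • v ∈ cov.expDomain x := by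
    have h1 : Filter.Tendsto (fun t : ℝ => t • v) (𝓝 0) (𝓝 (0 : E)) := by
      have : Continuous fun t : ℝ => t • v := by fun_prop
      simpa using this.tendsto 0
    exact h1.eventually (cov.expDomain_mem_nhds x)
  obtain ⟨s, hs, hs0⟩ := ((h.filter_mono nhdsWithin_le_nhds).and
    (self_mem_nhdsWithin (s := Ioi (0 : ℝ)))).exists
  have h2 : iteratedFDeriv ℝ r g 0 (fun _ => s • v) = T fun _ => s • v :=
    (cov.iteratedFDeriv_expPullback_diagonal_of_mem hf x hg hge hs).trans
      (congrArg (fun A : E [×r]→L[ℝ] F => A fun _ => s • v) hT)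
  rw [ContinuousMultilinearMap.map_smul_univ _ (fun _ => s) fun _ => v,
    ContinuousMultilinearMap.map_smul_univ _ (fun _ => s) fun _ => v] at h2
  have hs1 : (∏ _i : Fin r, s) ≠ 0 := Finset.prod_ne_zero_iff.2 fun _ _ => (ne_of_gt hs0)
  exact (smul_right_injective F hs1 h2).trans
    (congrArg (fun A : E [×r]→L[ℝ] F => A fun _ => v) hT).symm

/-- The differentials at the origin of `f ∘ exp` are the symmetrized iterated covariant
differentials of `f`. -/
theorem expDifferential_eq_symCovDifferential {f : M → F}
    (hf : ContMDiff 𝓘(ℝ, E) 𝓘(ℝ, F) ∞ f) (r : ℕ) (x : M) :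
    cov.expDifferential r f x = cov.symCovDifferential r f x := by
  -- Smoothness at `0` gives, for each finite `r`, a neighbourhood where `f ∘ exp` is `C^r`; a
  -- global `C^r` function agreeing with it near `0` has the same differentials there.
  obtain ⟨s, hs, hfs⟩ := (cov.contDiffAt_expPullback hf x).contDiffOn (m := (r : ℕ∞))
    (by exact_mod_cast le_top) (by simp)
  obtain ⟨g, hg, hge⟩ := exists_contDiff_eventuallyEq_of_contDiffOn hfs (by simpa using hs)
  obtain ⟨T, hT⟩ : ∃ T : E [×r]→L[ℝ] F, cov.iteratedCovDifferential f r x = T := ⟨_, rfl⟩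
  have h := iteratedFDeriv_eq_of_diagonal hg T fun v =>
    (cov.iteratedFDeriv_expPullback_diagonal hf x hg hge v).trans
      (congrArg (fun A : E [×r]→L[ℝ] F => A fun _ => v) hT)
  rw [(hge.iteratedFDeriv ℝ r).self_of_nhds] at h
  refine Eq.trans h ?_
  rw [← hT]
  rfl

end CovariantDerivative

/-- The identity of differentials holds for values in any real normed space: it is taken in `ℝ` for
the tensors and in `ℂ` for the quantizations. -/
theorem mainTheorem1
    {E : Type*} [NormedAddCommGroup E] [NormedSpace ℝ E] [FiniteDimensional ℝ E] [CompleteSpace E]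
    {M : Type*} [TopologicalSpace M] [T2Space M] [ChartedSpace E M] [IsManifold 𝓘(ℝ, E) ∞ M]
    (cov : CovariantDerivative 𝓘(ℝ, E) E (TangentSpace 𝓘(ℝ, E) : M → Type _))
    [CovariantDerivative.ContMDiffCovariantDerivative cov ∞] (htorsion : cov.torsion = 0) :
    (∀ x₀ : M, cov.expDomain x₀ ∈ 𝓝 0) ∧
    (∀ f : M → ℝ, ContMDiff 𝓘(ℝ, E) 𝓘(ℝ, ℝ) ∞ f → ∀ x₀ : M,
      ContDiffAt ℝ ∞ (cov.expPullback f x₀) 0 ∧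
      ∀ r : ℕ, cov.expDifferential r f x₀ = cov.symCovDifferential r f x₀) ∧
    (∀ (ħ : ℝ) (N : ℕ) (Φ : ∀ (r : ℕ) (x : M), CovariantDerivative.ContraTensor E r x)
      (f : M → ℂ), ContMDiff 𝓘(ℝ, E) 𝓘(ℝ, ℂ) ∞ f →
      cov.expQuantization ħ N Φ f = cov.directQuantization ħ N Φ f) := by
  refine ⟨cov.expDomain_mem_nhds, fun f hf x₀ => ⟨cov.contDiffAt_expPullback hf x₀,
    fun r => cov.expDifferential_eq_symCovDifferential hf r x₀⟩, fun ħ N Φ f hf => ?_⟩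
  funext x
  refine Finset.sum_congr rfl fun r _ => ?_
  rw [cov.expDifferential_eq_symCovDifferential hf r x]

end
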